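/- Let $n\ge 1$, $d>0$, and let $B_R$ denote the open ball of $\mathbb{R}^n$ with center $0$ and radius $R$; let $\mathcal S_n$ be the space of real symmetric $n\times n$ matrices with its usual partial order. Let $M_F\ge 0$, $\lambda_F>0$, and let $F:B_d\times\mathbb{R}\times\mathbb{R}^n\times\mathcal S_n\to\mathbb{R}$ be a function (for a so-called singular equation, $F$ is only considered for gradients $p\neq 0$, and in that case $p$ ranges over $\mathbb{R}^n\setminus\{0\}$ everywhere below) such that: (A) $F$ is continuous at gradients outside $B_{M_F}$, that is, on $B_d\times\mathbb{R}\times(\mathbb{R}^n\setminus B_{M_F})\times\mathcal S_n$; $F$ is degenerate elliptic, i.e. $X\le Y$ implies $F(x,r,p,Y)\le F(x,r,p,X)$; and $F$ is proper, i.e. non-decreasing in $r$; (strict ellipticity for large gradients) there are continuous functions $\sigma:B_d\to\mathbb{R}$ with $\|\sigma\|_{L^n(B_d)}<\infty$ and $g:B_d\times\mathbb{R}\to\mathbb{R}$ such that, for all $x\in B_d$, $r\in\mathbb{R}$, $p\in\mathbb{R}^n$ and $X\in\mathcal S_n$, $$X\ge 0,\quad |p|\ge M_F,\quad F(x,r,p,X)\ge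 0\ \Longrightarrow\ -\lambda_F\,\mathrm{tr}(X)+\sigma(x)|p|+g(x,r)\ge 0 .$$ Let $u:\overline{B_d}\to\mathbb{R}$ be lower semi-continuous and a viscosity super-solution of $F(x,u,Du,D^2u)=0$ in $B_d$: for all $x\in B_d$, $F(x,u(x),p,X)\ge 0$ for every $(p,X)$ in the second order subjet $D^{2,-}u(x)$, i.e. for every $(p,X)\in\mathbb{R}^n\times\mathcal S_n$ such that $u(y)\ge u(x)+p\cdot(y-x)+\frac12 X(y-x)\cdot(y-x)+o(|y-x|^2)$ as $y\to x$. Write $u^-=\max(-u,0)$, $M_\partial=\sup_{\partial B_d}u^-$, $f(x)=g(x,-M_\partial)$, $f^+=\max(f,0)$, and let $\Gamma(u)$ be the convex hull (largest convex minorant) on $B_{2d}$ of the function equal to $\min(u+M_\partial,0)$ on $B_d$ and to $0$ on $B_{2d}\setminus B_d$. Then $$\sup_{B_d}u^-\ \le\ \sup_{\partial B_d}u^-+C\,d\left(M_F+\Big(\int_{B_d\cap\{u+M_\partial=\Gamma(u)\}}(f^+)^n\Big)^{1/n}\right),$$ where $C$ is a constant depending only on $\|\sigma\|_{L^n(B_d)}$,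 $n$ and $\lambda_F$. -/

import Mathlib

open Set Filter Topology MeasureTheory

namespace ABP

/-- Second order subjet `D^{2,-} u (x)`: the pairs `(p, X)`, `X` symmetric, with
`u y ≥ u x + ⟨p, y - x⟩ + ½ ⟨X (y - x), y - x⟩ + o(|y - x|²)` as `y → x`. -/
def subjet {n : ℕ} (u : EuclideanSpace ℝ (Fin n) → ℝ) (x : EuclideanSpace ℝ (Fin n)) :
    Set (EuclideanSpace ℝ (Fin n) × Matrix (Fin n) (Fin n) ℝ) :=
  {q | q.2.IsSymm ∧ ∀ ε : ℝ, 0 < ε → ∀ᶠ y in 𝓝 x,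
    u x + inner ℝ q.1 (y - x)
      + (1 / 2) * ((y - x).ofLp ⬝ᵥ (q.2.mulVec (y - x).ofLp))
      - ε * ‖y - x‖ ^ 2 ≤ u y}

/-- Assumption (A) on a nonlinearity `F (x, r, p, X)`, for `x ∈ Ω`. The set `P` is the set of
gradients at which `F` is considered: the whole space, or (singular equations) the nonzero
vectors. -/
structure AssumptionA {n : ℕ} (Ω P : Set (EuclideanSpace ℝ (Fin n))) (M : ℝ)
    (F : EuclideanSpace ℝ (Fin n) → ℝ → EuclideanSpace ℝ (Fin n) →
      Matrix (Fin n) (Fin n) ℝ → ℝ) : Prop where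
  /-- continuity for gradients outside the open ball of radius `M` -/
  continuous : ContinuousOn
    (fun q : EuclideanSpace ℝ (Fin n) × ℝ × EuclideanSpace ℝ (Fin n) ×
      Matrix (Fin n) (Fin n) ℝ => F q.1 q.2.1 q.2.2.1 q.2.2.2)
    {q | q.1 ∈ Ω ∧ q.2.2.1 ∈ P ∧ M ≤ ‖q.2.2.1‖ ∧ q.2.2.2.IsSymm}
  /-- degenerate ellipticity -/
  elliptic : ∀ x ∈ Ω, ∀ r : ℝ, ∀ p ∈ P, ∀ X Y : Matrix (Fin n) (Fin n) ℝ,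
    X.IsSymm → Y.IsSymm → (Y - X).PosSemidef → F x r p Y ≤ F x r p X
  /-- properness -/
  proper : ∀ x ∈ Ω, ∀ p ∈ P, ∀ X : Matrix (Fin n) (Fin n) ℝ, X.IsSymm →
    ∀ r s : ℝ, r ≤ s → F x r p X ≤ F x s p X

/-- Strict ellipticity for large gradients (`|p| ≥ M`), with ellipticity constant `lam`, first
order coefficient `σ` and zero order term `g`. -/
def StrictlyEllipticLarge {n : ℕ} (Ω P : Set (EuclideanSpace ℝ (Fin n))) (M lam : ℝ)
    (σ : EuclideanSpace ℝ (Fin n) → ℝ) (g : EuclideanSpace ℝ (Fin n) → ℝ → ℝ)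
    (F : EuclideanSpace ℝ (Fin n) → ℝ → EuclideanSpace ℝ (Fin n) →
      Matrix (Fin n) (Fin n) ℝ → ℝ) : Prop :=
  ∀ x ∈ Ω, ∀ r : ℝ, ∀ p ∈ P, ∀ X : Matrix (Fin n) (Fin n) ℝ,
    X.PosSemidef → M ≤ ‖p‖ → 0 ≤ F x r p X →
      0 ≤ -lam * X.trace + σ x * ‖p‖ + g x r

/-- Viscosity super-solutions of `F (x, u, Du, D²u) = 0` in the open set `Ω`: for all `x ∈ Ω` and
all `(p, X) ∈ D^{2,-} u (x)` with `p ∈ P`, one has `F (x, u x, p, X) ≥ 0`. (Lower semi-continuity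
is stated separately.) -/
def IsSupersolution {n : ℕ} (Ω P : Set (EuclideanSpace ℝ (Fin n)))
    (F : EuclideanSpace ℝ (Fin n) → ℝ → EuclideanSpace ℝ (Fin n) →
      Matrix (Fin n) (Fin n) ℝ → ℝ)
    (u : EuclideanSpace ℝ (Fin n) → ℝ) : Prop :=
  ∀ x ∈ Ω, ∀ q ∈ subjet u x, q.1 ∈ P → 0 ≤ F x (u x) q.1 q.2

/-- Supremum over `S` of the negative part `u⁻ = max (-u) 0`. -/
noncomputable def supNeg {n : ℕ} (u : EuclideanSpace ℝ (Fin n) → ℝ)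
    (S : Set (EuclideanSpace ℝ (Fin n))) : ℝ :=
  sSup ((fun x => max (-u x) 0) '' S)

/-- Convex hull (largest convex minorant) on the set `D` of the function `U`. -/
noncomputable def convexHullOn {n : ℕ} (D : Set (EuclideanSpace ℝ (Fin n)))
    (U : EuclideanSpace ℝ (Fin n) → ℝ) (x : EuclideanSpace ℝ (Fin n)) : ℝ :=
  sSup {t | ∃ φ : EuclideanSpace ℝ (Fin n) → ℝ,
    ConvexOn ℝ D φ ∧ (∀ y ∈ D, φ y ≤ U y) ∧ t = φ x}

open Classical in
/-- `min (u + m, 0)` on the ball `B_d`, extended by `0`. -/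
noncomputable def truncExt {n : ℕ} (d m : ℝ) (u : EuclideanSpace ℝ (Fin n) → ℝ)
    (x : EuclideanSpace ℝ (Fin n)) : ℝ :=
  if x ∈ Metric.ball (0 : EuclideanSpace ℝ (Fin n)) d then min (u x + m) 0 else 0

/-- `Γ (u)`: the convex hull on `B_{2d}` of `min (u + M_∂, 0)` extended by `0`, where
`M_∂ = sup_{∂B_d} u⁻`. -/
noncomputable def Gam {n : ℕ} (d : ℝ) (u : EuclideanSpace ℝ (Fin n) → ℝ) :
    EuclideanSpace ℝ (Fin n) → ℝ :=
  convexHullOn (Metric.ball 0 (2 * d)) (truncExt d (supNeg u (Metric.sphere 0 d)) u)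

/-- The contact set `B_d ∩ {u + M_∂ = Γ (u)}`. -/
def contactSet {n : ℕ} (d : ℝ) (u : EuclideanSpace ℝ (Fin n) → ℝ) :
    Set (EuclideanSpace ℝ (Fin n)) :=
  Metric.ball 0 d ∩ {x | u x + supNeg u (Metric.sphere 0 d) = Gam d u x}

end ABP

/-! Let `v = min (u + M_∂, 0)`, extended by `0`, and let `m` be its depth. Sliding an affine
function of slope `p` up from below touches `v` on the closed ball of radius `2d`. If `3d|p| < m`,
the touching point has `v < 0`, so it lies in `B_d` and in the contact set. The proof measures this
set of slopes and argues by contradiction from a large `m`.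

Ellipticity is available only for gradients of norm at least `M`, so only slopes with `r ≤ |p| ≤ 2^N
r`, `r > M`, are used. On them the map from touching point to slope is single-valued and Lipschitz
(`exists_lipschitz_slope`): two very different slopes at nearby points would let a parabola of large
one-directional opening touch `v` from below (`exists_parabola_touching`), against the equation. A
Lipschitz slope map is differentiable almost everywhere. At density points of its domain the
derivative is symmetric, positive semidefinite, and a subjet matrix of `v` (`fderiv_slope`). The
equation then bounds its trace, hence its determinant, and the change of variables inequality bounds
the volume of sets of slopes (`volume_image_slope_le`).

The drift term is handled by dyadic annuli of slopes (`mul_volume_ball_le`). On `ρ < |p| ≤ 2ρ` the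
volume is at least `ρ^n |B_1|`, and the Jacobian is at most a constant times `(ρ σ)^n + f^n`.
Division by `ρ^n ≥ r^n` removes the scale from the `σ` term, so each annulus uses up a fixed amount
of `∫ σ^n + r^{-n} ∫ f^n`. The touching sets of different annuli are disjoint, so `N` is bounded by
`n`, `lam` and `S`; a larger `N` gives the contradiction. -/

namespace ABP

/-! ### Affine functions touching a well from below -/

/-- `p` is the slope of an affine function touching `v` from below at `x`, relative to `D`. -/
def IsSlope {E : Type*} [NormedAddCommGroup E] [InnerProductSpace ℝ E] (D : Set E) (v : E → ℝ)
    (x p : E) : Prop :=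
  ∀ y ∈ D, v x + inner ℝ p (y - x) ≤ v y

/-- A lower semicontinuous non-positive function, supported in the ball of radius `d`, which
takes a value at most `-m < 0`. -/
structure IsWell {E : Type*} [NormedAddCommGroup E] (d m : ℝ) (v : E → ℝ) : Prop where
  d_pos : 0 < d
  m_pos : 0 < m
  lsc : LowerSemicontinuous v
  nonpos : ∀ x, v x ≤ 0
  mem_ball : ∀ x, v x < 0 → x ∈ Metric.ball (0 : E) d
  exists_le : ∃ x, v x ≤ -m

section

variable {E : Type*} [NormedAddCommGroup E] [InnerProductSpace ℝ E]

/-- The affine function is at most `-m` at a deepest point of the well, and that point is within `2d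
+ d = 3d` of any `z`. Taking `z = x` shows that slopes with `3d‖p‖ < m` touch where `v < 0`. -/
lemma IsWell.affine_le {d m : ℝ} {v : E → ℝ} (hv : IsWell d m v) {x p : E}
    (hp : IsSlope (Metric.closedBall 0 (2 * d)) v x p) {z : E}
    (hz : z ∈ Metric.closedBall (0 : E) (2 * d)) :
    v x + inner ℝ p (z - x) ≤ -m + 3 * d * ‖p‖ := by
  obtain ⟨y, hy⟩ := hv.exists_le
  have hyb := hv.mem_ball y (by linarith [hv.m_pos])
  have hd := hv.d_pos
  rw [mem_ball_zero_iff] at hyb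
  rw [mem_closedBall_zero_iff] at hz
  have h1 := hp y (by rw [mem_closedBall_zero_iff]; linarith)
  have h2 : inner ℝ p (z - x) = inner ℝ p (y - x) + inner ℝ p (z - y) := by
    rw [← inner_add_right]; congr 1; abel
  have h3 : inner ℝ p (z - y) ≤ ‖p‖ * ‖z - y‖ := real_inner_le_norm _ _
  have h4 : ‖z - y‖ ≤ 3 * d := (norm_sub_le _ _).trans (by linarith)
  have h5 : ‖p‖ * ‖z - y‖ ≤ ‖p‖ * (3 * d) := by gcongr
  linarith

lemma IsWell.isCompact_le [FiniteDimensional ℝ E] {d m : ℝ} {v : E → ℝ} (hv : IsWell d m v)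
    {c : ℝ} (hc : c < 0) : IsCompact {x | v x ≤ c} := by
  refine Metric.isCompact_of_isClosed_isBounded (hv.lsc.isClosed_preimage c) ?_
  exact Metric.isBounded_ball.subset fun x hx => hv.mem_ball x (lt_of_le_of_lt hx hc)

lemma IsWell.exists_slope [FiniteDimensional ℝ E] {d m : ℝ} {v : E → ℝ} (hv : IsWell d m v)
    (p : E) : ∃ x ∈ Metric.closedBall (0 : E) (2 * d),
      IsSlope (Metric.closedBall 0 (2 * d)) v x p := by
  have hd := hv.d_pos
  have hl : LowerSemicontinuous (fun y => v y + inner ℝ (-p) y) :=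
    hv.lsc.add (Continuous.lowerSemicontinuous (by fun_prop))
  obtain ⟨x, hx, hmin⟩ := (hl.lowerSemicontinuousOn _).exists_isMinOn
    (Metric.nonempty_closedBall.2 (by linarith : 0 ≤ 2 * d))
    (isCompact_closedBall (0 : E) (2 * d))
  refine ⟨x, hx, fun y hy => ?_⟩
  have := hmin hy
  simp only [inner_neg_left, mem_ofPred_eq] at this
  rw [inner_sub_right]
  linarith

/-- The set of points of `D` at which `v` has a slope belonging to `K`. -/
def touchingSet (D : Set E) (v : E → ℝ) (K : Set E) : Set E :=
  {x | x ∈ D ∧ ∃ p ∈ K, IsSlope D v x p}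

/-- Lower semicontinuity makes the touching relation closed in the pair (point, slope). The touching
set is the projection of a compact part of it. -/
lemma isCompact_touchingSet {D : Set E} {v : E → ℝ} {K : Set E} (hD : IsCompact D)
    (hK : IsCompact K) (hv : LowerSemicontinuous v) : IsCompact (touchingSet D v K) := by
  have hclosed : IsClosed {q : E × E | IsSlope D v q.1 q.2} := by
    have : {q : E × E | IsSlope D v q.1 q.2} =
        ⋂ y ∈ D, (fun q : E × E => v q.1 + inner ℝ q.2 (y - q.1)) ⁻¹' Iic (v y) := by
      ext q; simp [IsSlope]
    rw [this]
    refine isClosed_biInter fun y _ => LowerSemicontinuous.isClosed_preimage ?_ _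
    exact (hv.comp continuous_fst).add
      (Continuous.lowerSemicontinuous (by fun_prop))
  have : touchingSet D v K = Prod.fst '' ((D ×ˢ K) ∩ {q : E × E | IsSlope D v q.1 q.2}) := by
    ext x
    simp only [touchingSet, mem_ofPred_eq, mem_image, mem_inter_iff, mem_prod, Prod.exists]
    constructor
    · rintro ⟨hx, p, hp, h⟩
      exact ⟨x, p, ⟨⟨hx, hp⟩, h⟩, rfl⟩
    · rintro ⟨x', p, ⟨⟨hx, hp⟩, h⟩, rfl⟩
      exact ⟨hx, p, hp, h⟩
  rw [this]
  exact ((hD.prod hK).inter_right hclosed).image continuous_fst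

end

/-! ### Lipschitz dependence of large slopes on the touching point -/

/-- The one-sided Pucci-type inequality satisfied, at gradients of norm at least `M`, by the
positive semidefinite second order subjets of `v` at points where `v` is negative. -/
def HasConvexBound {n : ℕ} (M lam : ℝ) (s f v : EuclideanSpace ℝ (Fin n) → ℝ) : Prop :=
  ∀ x, v x < 0 → ∀ q ∈ subjet v x, M ≤ ‖q.1‖ → q.1 ≠ 0 → q.2.PosSemidef →
    lam * q.2.trace ≤ s x * ‖q.1‖ + f x

lemma mem_subjet_of_quadratic {n : ℕ} {v : EuclideanSpace ℝ (Fin n) → ℝ}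
    {z q e : EuclideanSpace ℝ (Fin n)} {a : ℝ}
    (h : ∀ᶠ y in 𝓝 z, v z + inner ℝ q (y - z) + a / 2 * (inner ℝ e (y - z)) ^ 2 ≤ v y) :
    (q, a • Matrix.vecMulVec e.ofLp e.ofLp) ∈ subjet v z := by
  refine ⟨?_, fun ε hε => ?_⟩
  · ext i j; simp [Matrix.vecMulVec, mul_comm]
  · filter_upwards [h] with y hy
    have h1 : (y - z).ofLp ⬝ᵥ ((a • Matrix.vecMulVec e.ofLp e.ofLp).mulVec (y - z).ofLp)
        = a * (inner ℝ e (y - z)) ^ 2 := by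
      have h2 : inner ℝ e (y - z) = e.ofLp ⬝ᵥ (y - z).ofLp := by
        rw [EuclideanSpace.inner_eq_star_dotProduct, dotProduct_comm]; simp
      rw [h2, Matrix.smul_mulVec, Matrix.vecMulVec_mulVec]
      simp only [dotProduct_smul, smul_eq_mul, MulOpposite.smul_eq_mul_unop, MulOpposite.unop_op]
      rw [dotProduct_comm (y - z).ofLp e.ofLp]
      ring
    have h3 : 0 ≤ ε * ‖y - z‖ ^ 2 := by positivity
    simp only [h1]
    linarith

set_option maxHeartbeats 800000 in
/-- Two affine functions touching `v` at points at distance at most `ρ`, with very different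
slopes, leave room for a convex parabola of large opening touching `v` from below. -/
lemma exists_parabola_touching {n : ℕ} {d m : ℝ} {v : EuclideanSpace ℝ (Fin n) → ℝ}
    (hv : IsWell d m v) {x₀ x₁ p₀ p₁ : EuclideanSpace ℝ (Fin n)}
    (hx₀ : x₀ ∈ Metric.closedBall (0 : EuclideanSpace ℝ (Fin n)) (2 * d))
    (hx₁ : x₁ ∈ Metric.closedBall (0 : EuclideanSpace ℝ (Fin n)) (2 * d))
    (h₀ : IsSlope (Metric.closedBall 0 (2 * d)) v x₀ p₀)
    (h₁ : IsSlope (Metric.closedBall 0 (2 * d)) v x₁ p₁) {ρ k a : ℝ} (hρ : 0 < ρ)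
    (hx : ‖x₁ - x₀‖ ≤ ρ) (hk : 0 < k) (hkp : k ≤ ‖p₁ - p₀‖) (ha : 0 < a) (hak : 8 * a * ρ ≤ k)
    (hneg : 3 * d * ‖p₀‖ + 4 * k * ρ < m) :
    ∃ z q e : EuclideanSpace ℝ (Fin n), v z ≤ -m + 3 * d * ‖p₀‖ + 4 * k * ρ ∧ ‖e‖ = 1 ∧
      ‖q - p₀‖ ≤ k ∧ (q, a • Matrix.vecMulVec e.ofLp e.ofLp) ∈ subjet v z := by
  set D := Metric.closedBall (0 : EuclideanSpace ℝ (Fin n)) (2 * d) with hD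
  set κ := ‖p₁ - p₀‖ with hκ
  have hκ0 : 0 < κ := hk.trans_le hkp
  obtain ⟨e, he⟩ : ∃ e, e = κ⁻¹ • (p₁ - p₀) := ⟨_, rfl⟩
  have hen : ‖e‖ = 1 := by
    rw [he, norm_smul, ← hκ, norm_inv, Real.norm_of_nonneg hκ0.le, inv_mul_cancel₀ hκ0.ne']
  have hpe : p₁ - p₀ = κ • e := by rw [he, smul_smul, mul_inv_cancel₀ hκ0.ne', one_smul]
  obtain ⟨b, hb⟩ : ∃ b, b = κ⁻¹ * (v x₁ - v x₀ - inner ℝ p₁ x₁ + inner ℝ p₀ x₀) := ⟨_, rfl⟩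
  -- The difference of the two affine functions is `κ t`, with `t` of unit gradient, so `v` minus
  -- the first one dominates both `0` and `κ t`. Touching forces `-ρ ≤ t x₀ ≤ 0 ≤ t x₁`.
  set t : EuclideanSpace ℝ (Fin n) → ℝ := fun z => inner ℝ e z + b with ht
  have hκb : κ * b = v x₁ - v x₀ - inner ℝ p₁ x₁ + inner ℝ p₀ x₀ := by
    rw [hb, mul_inv_cancel_left₀ hκ0.ne']
  have hκe : ∀ z, κ * inner ℝ e z = inner ℝ p₁ z - inner ℝ p₀ z := by
    intro z
    rw [← inner_sub_left, hpe, real_inner_smul_left]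
  have hl : ∀ z, v x₁ + inner ℝ p₁ (z - x₁) = v x₀ + inner ℝ p₀ (z - x₀) + κ * t z := by
    intro z
    have := hκe z
    simp only [ht, mul_add, hκb, inner_sub_right]
    linarith
  have htcont : Continuous t := by fun_prop
  have htsub : ∀ y z, t y - t z = inner ℝ e (y - z) := by
    intro y z; simp only [ht, inner_sub_right]; ring
  have ht0 : t x₀ ≤ 0 := by
    have := h₁ x₀ hx₀
    rw [hl] at this
    simp only [sub_self, inner_zero_right] at this
    nlinarith
  have ht1 : 0 ≤ t x₁ := by
    have := h₀ x₁ hx₁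
    have h := hl x₁
    simp only [sub_self, inner_zero_right] at h
    nlinarith
  have ht01 : -ρ ≤ t x₀ := by
    have h1 := htsub x₁ x₀
    have h2 : inner ℝ e (x₁ - x₀) ≤ ‖e‖ * ‖x₁ - x₀‖ := real_inner_le_norm _ _
    rw [hen] at h2
    linarith
  -- The parabola lies above `w` at `x₀`, because `φ (t x₀) > 0`. It lies below the wedge `max (0, κ
  -- t)` at `t = ±4ρ`, because `8aρ ≤ k`. Hence the minimum of `w - φ ∘ t` over the strip is
  -- attained with `|t| < 4ρ`.
  set φ : ℝ → ℝ := fun τ => k * τ / 2 + a * τ ^ 2 / 2 + k * ρ with hφ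
  set w : EuclideanSpace ℝ (Fin n) → ℝ := fun z => v z - (v x₀ + inner ℝ p₀ (z - x₀)) with hw
  have hw0 : ∀ z ∈ D, 0 ≤ w z := fun z hz => by have := h₀ z hz; simp only [hw]; linarith
  have hwκ : ∀ z ∈ D, κ * t z ≤ w z := fun z hz => by
    have := h₁ z hz; rw [hl] at this; simp only [hw]; linarith
  have hlsc : LowerSemicontinuous
      (fun z => v z + (-(v x₀ + inner ℝ p₀ (z - x₀)) - φ (t z))) :=
    hv.lsc.add (Continuous.lowerSemicontinuous (by simp only [hφ]; fun_prop))
  have hcomp : IsCompact (D ∩ {z | |t z| ≤ 4 * ρ}) :=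
    (isCompact_closedBall _ _).inter_right (isClosed_le (by fun_prop) continuous_const)
  have hx0mem : x₀ ∈ D ∩ {z | |t z| ≤ 4 * ρ} :=
    ⟨hx₀, by rw [mem_ofPred_eq, abs_le]; constructor <;> linarith⟩
  obtain ⟨z, ⟨hzD, hzt⟩, hmin⟩ := (hlsc.lowerSemicontinuousOn _).exists_isMinOn ⟨x₀, hx0mem⟩ hcomp
  have hwz : w z < φ (t z) := by
    have := hmin hx0mem
    simp only [mem_ofPred_eq, sub_self, inner_zero_right] at this
    have h2 : 0 < φ (t x₀) := by simp only [hφ]; nlinarith [sq_nonneg (t x₀)]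
    simp only [hw]
    linarith
  rw [mem_ofPred_eq, abs_le] at hzt
  have hzlt : |t z| < 4 * ρ := by
    rw [abs_lt]
    constructor
    · rcases hzt.1.lt_or_eq with h | h
      · exact h
      · exfalso
        have := hw0 z hzD
        simp only [hφ, ← h] at hwz
        nlinarith
    · rcases hzt.2.lt_or_eq with h | h
      · exact h
      · exfalso
        have h3 := hwκ z hzD
        have h4 : k * (4 * ρ) ≤ κ * (4 * ρ) := by gcongr
        simp only [hφ, h] at hwz
        rw [h] at h3
        nlinarith
  have hvz : v z ≤ -m + 3 * d * ‖p₀‖ + 4 * k * ρ := by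
    have h1 := hv.affine_le h₀ hzD
    have h2 : φ (t z) ≤ 4 * k * ρ := by
      simp only [hφ]
      have h3 : (t z) ^ 2 ≤ (4 * ρ) ^ 2 := sq_le_sq' hzt.1 hzt.2
      have h4 : k * t z ≤ k * (4 * ρ) := by gcongr; exact hzt.2
      have h5 : a * (t z) ^ 2 ≤ a * (4 * ρ) ^ 2 := by gcongr
      nlinarith
    simp only [hw] at hwz
    linarith
  have hzb := hv.mem_ball z (by linarith)
  -- The gradient is that of the touching affine function plus `φ'(t z) e`, where `|a t z| ≤ k/2`.
  refine ⟨z, p₀ + (k / 2 + a * t z) • e, e, hvz, hen, ?_, ?_⟩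
  · have h1 : |a * t z| ≤ k / 2 := by
      rw [abs_mul, abs_of_pos ha]
      have : a * |t z| ≤ a * (4 * ρ) := by gcongr
      linarith
    rw [abs_le] at h1
    rw [add_sub_cancel_left, norm_smul, hen, mul_one, Real.norm_eq_abs, abs_le]
    constructor <;> linarith
  · apply mem_subjet_of_quadratic
    have hd := hv.d_pos
    have hn1 : ∀ᶠ y in 𝓝 z, y ∈ D := by
      filter_upwards [Metric.isOpen_ball.mem_nhds hzb] with y hy
      exact Metric.closedBall_subset_closedBall (by linarith) (Metric.ball_subset_closedBall hy)
    have hn2 : ∀ᶠ y in 𝓝 z, |t y| < 4 * ρ :=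
      (isOpen_lt (by fun_prop) continuous_const).mem_nhds hzlt
    filter_upwards [hn1, hn2] with y hy1 hy2
    have h1 : v z + (-(v x₀ + inner ℝ p₀ (z - x₀)) - φ (t z)) ≤
      v y + (-(v x₀ + inner ℝ p₀ (y - x₀)) - φ (t y)) := hmin ⟨hy1, hy2.le⟩
    have h2 : inner ℝ p₀ (y - x₀) - inner ℝ p₀ (z - x₀) = inner ℝ p₀ (y - z) := by
      simp only [inner_sub_right]; ring
    have h3 : t y = t z + inner ℝ e (y - z) := by linarith [htsub y z]
    rw [inner_add_left, inner_smul_left]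
    simp only [hφ, h3] at h1
    simp only [conj_trivial]
    have h4 : k * (t z + inner ℝ e (y - z)) / 2 + a * (t z + inner ℝ e (y - z)) ^ 2 / 2 =
        k * t z / 2 + a * t z ^ 2 / 2 + (k / 2 + a * t z) * inner ℝ e (y - z)
          + a / 2 * inner ℝ e (y - z) ^ 2 := by ring
    linarith

/-- Slopes of large norm depend in a Lipschitz way on the touching point. -/
lemma exists_lipschitz_slope {n : ℕ} {d m M lam r R : ℝ}
    {v s f : EuclideanSpace ℝ (Fin n) → ℝ} (hv : IsWell d m v) (hlam : 0 < lam)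
    (hs : ContinuousOn s (Metric.ball 0 d)) (hf : ContinuousOn f (Metric.ball 0 d))
    (hs0 : ∀ x, 0 ≤ s x)
    (hb : HasConvexBound M lam s f v) (hM : 0 ≤ M) (hr : M < r) (hR : 3 * d * R < m) :
    ∃ L : ℝ, 0 ≤ L ∧ ∀ x₀ ∈ Metric.closedBall (0 : EuclideanSpace ℝ (Fin n)) (2 * d),
      ∀ x₁ ∈ Metric.closedBall (0 : EuclideanSpace ℝ (Fin n)) (2 * d), ∀ p₀ p₁,
      IsSlope (Metric.closedBall 0 (2 * d)) v x₀ p₀ →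
      IsSlope (Metric.closedBall 0 (2 * d)) v x₁ p₁ →
      r ≤ ‖p₀‖ → ‖p₀‖ ≤ R → ‖p₁‖ ≤ R → ‖p₁ - p₀‖ ≤ L * ‖x₁ - x₀‖ := by
  have hd := hv.d_pos
  set c := m - 3 * d * R with hc
  have hc0 : 0 < c := by linarith
  -- Slopes perturbed by at most `η` still have norm above `M`.
  set η := (r - M) / 2 with hη
  have hη0 : 0 < η := by simp only [hη]; linarith
  have hcpt := hv.isCompact_le (c := -c / 2) (by linarith)
  have hsub : {x | v x ≤ -c / 2} ⊆ Metric.ball 0 d := fun x hx =>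
    hv.mem_ball x (by have : v x ≤ -c / 2 := hx; linarith)
  have hbdd : BddAbove ((fun x => s x * (|R| + η) + f x) '' {x | v x ≤ -c / 2}) :=
    hcpt.bddAbove_image (((hs.mono hsub).mul continuousOn_const).add (hf.mono hsub))
  obtain ⟨K, hK⟩ := hbdd
  -- This opening contradicts the convex bound: `lam * a` exceeds `K`, which bounds its right-hand
  -- side on `{v ≤ -c/2}`. The scale `ρ₀` keeps the touching point in that set.
  set a := (|K| + 1) / lam with ha
  have ha0 : 0 < a := by positivity
  set ρ₀ := c / (8 * η) with hρ₀
  have hρ₀0 : 0 < ρ₀ := by positivity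
  -- the truncated difference of slopes is controlled at small scales
  have key : ∀ x₀ ∈ Metric.closedBall (0 : EuclideanSpace ℝ (Fin n)) (2 * d),
      ∀ x₁ ∈ Metric.closedBall (0 : EuclideanSpace ℝ (Fin n)) (2 * d), ∀ p₀ p₁,
      IsSlope (Metric.closedBall 0 (2 * d)) v x₀ p₀ →
      IsSlope (Metric.closedBall 0 (2 * d)) v x₁ p₁ →
      r ≤ ‖p₀‖ → ‖p₀‖ ≤ R → ∀ ρ, 0 < ρ → ρ ≤ ρ₀ → ‖x₁ - x₀‖ ≤ ρ →
      min ‖p₁ - p₀‖ η < 8 * a * ρ := by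
    intro x₀ hx₀ x₁ hx₁ p₀ p₁ h₀ h₁ hr0 hR0 ρ hρ hρρ hxρ
    by_contra! hcon
    have hkη : min ‖p₁ - p₀‖ η ≤ η := min_le_right _ _
    set k := min ‖p₁ - p₀‖ η with hk
    have hk0 : 0 < k := lt_of_lt_of_le (by positivity) hcon
    have h4 : 4 * k * ρ ≤ c / 2 := by
      have : k * ρ ≤ η * ρ₀ := by gcongr
      have h5 : η * ρ₀ = c / 8 := by rw [hρ₀]; field_simp
      linarith
    have h3 : 3 * d * ‖p₀‖ ≤ 3 * d * R := by gcongr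
    obtain ⟨z, q, e, hvz, he, hq, hsj⟩ := exists_parabola_touching hv hx₀ hx₁ h₀ h₁ hρ hxρ hk0
      (min_le_left _ _) ha0 hcon (by linarith)
    have hvz' : v z ≤ -c / 2 := by linarith
    have hq1 : ‖p₀‖ - η ≤ ‖q‖ := by
      have := norm_sub_norm_le p₀ q
      rw [norm_sub_rev] at this
      linarith
    have hq2 : ‖q‖ ≤ |R| + η := by
      have := norm_sub_norm_le q p₀
      linarith [le_abs_self R]
    have hMq : M < ‖q‖ := by simp only [hη] at hq1; linarith
    have hpsd : (a • Matrix.vecMulVec e.ofLp e.ofLp).PosSemidef := by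
      refine Matrix.PosSemidef.smul ?_ ha0.le
      simpa using Matrix.posSemidef_vecMulVec_self_star e.ofLp
    have htr : (a • Matrix.vecMulVec e.ofLp e.ofLp).trace = a := by
      have h1 : e.ofLp ⬝ᵥ e.ofLp = 1 := by
        have : inner ℝ e e = e.ofLp ⬝ᵥ e.ofLp := by
          rw [EuclideanSpace.inner_eq_star_dotProduct]; simp
        rw [← this, real_inner_self_eq_norm_sq, he]; norm_num
      rw [Matrix.trace_smul, Matrix.trace_vecMulVec, h1, smul_eq_mul, mul_one]
    have h6 := hb z (by linarith) _ hsj hMq.le (norm_pos_iff.1 (hM.trans_lt hMq)) hpsd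
    simp only [htr] at h6
    have h7 : s z * (|R| + η) + f z ≤ K := hK (mem_image_of_mem _ hvz')
    have h8 : s z * ‖q‖ ≤ s z * (|R| + η) := mul_le_mul_of_nonneg_left hq2 (hs0 z)
    have h9 : lam * a = |K| + 1 := by rw [ha]; field_simp
    linarith [le_abs_self K]
  -- Below this scale `8aρ ≤ η`, so the truncation in `key` is inactive. Letting `ρ` decrease to
  -- `‖x₁ - x₀‖` gives the Lipschitz bound, including the case `x₁ = x₀`. At larger distances the
  -- crude bound `2|R|` suffices.
  set ρ₁ := min ρ₀ (η / (8 * a)) with hρ₁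
  have hρ₁0 : 0 < ρ₁ := lt_min hρ₀0 (by positivity)
  refine ⟨max (8 * a) (2 * |R| / ρ₁), le_max_of_le_left (by positivity), ?_⟩
  intro x₀ hx₀ x₁ hx₁ p₀ p₁ h₀ h₁ hr0 hR0 hR1
  rcases lt_or_ge ‖x₁ - x₀‖ ρ₁ with hlt | hge
  · have h1 : ‖p₁ - p₀‖ ≤ 8 * a * ‖x₁ - x₀‖ := by
      refine le_of_forall_gt_imp_ge_of_dense fun b hb' => ?_
      set ρ := min (b / (8 * a)) ρ₁ with hρ
      have hb1 : ‖x₁ - x₀‖ < b / (8 * a) := by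
        rw [lt_div_iff₀ (by positivity)]; linarith
      have hρx : ‖x₁ - x₀‖ < ρ := lt_min hb1 hlt
      have hρ0 : 0 < ρ := (norm_nonneg _).trans_lt hρx
      have h2 := key x₀ hx₀ x₁ hx₁ p₀ p₁ h₀ h₁ hr0 hR0 ρ hρ0
        ((min_le_right _ _).trans (min_le_left _ _)) hρx.le
      have h3 : 8 * a * ρ ≤ b := by
        have := min_le_left (b / (8 * a)) ρ₁
        rw [le_div_iff₀ (by positivity)] at this
        linarith
      have h4 : 8 * a * ρ ≤ η := by
        have : ρ ≤ η / (8 * a) := (min_le_right _ _).trans (min_le_right _ _)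
        rw [le_div_iff₀ (by positivity)] at this
        linarith
      rcases min_lt_iff.1 h2 with h5 | h5
      · linarith
      · linarith
    exact h1.trans (mul_le_mul_of_nonneg_right (le_max_left _ _) (norm_nonneg _))
  · have h1 : ‖p₁ - p₀‖ ≤ 2 * |R| := (norm_sub_le _ _).trans (by linarith [le_abs_self R])
    calc ‖p₁ - p₀‖ ≤ 2 * |R| / ρ₁ * ρ₁ := by rwa [div_mul_cancel₀ _ hρ₁0.ne']
      _ ≤ max (8 * a) (2 * |R| / ρ₁) * ‖x₁ - x₀‖ := by
        gcongr
        exact le_max_right _ _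

/-! ### Second order expansion at density points -/

section

variable {E : Type*} [NormedAddCommGroup E] [InnerProductSpace ℝ E]

/-- Near a density point of `A`, every point is close to `A`, on a relative scale. -/
lemma exists_mem_near_of_density [FiniteDimensional ℝ E] [MeasurableSpace E] [BorelSpace E]
    {μ : Measure E} [μ.IsAddHaarMeasure] {A : Set E} {x : E}
    (h : Tendsto (fun r => μ (A ∩ Metric.closedBall x r) / μ (Metric.closedBall x r))
      (𝓝[>] 0) (𝓝 1)) {ε : ℝ} (hε : 0 < ε) :
    ∃ δ > 0, ∀ r, 0 < r → r < δ → ∀ y ∈ Metric.closedBall x r, ∃ z ∈ A, ‖z - y‖ ≤ ε * r := by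
  wlog hε1 : ε ≤ 1 generalizing ε
  · obtain ⟨δ, hδ, h'⟩ := this one_pos le_rfl
    refine ⟨δ, hδ, fun r hr hrδ y hy => ?_⟩
    obtain ⟨z, hz, hzy⟩ := h' r hr hrδ y hy
    exact ⟨z, hz, hzy.trans (by nlinarith)⟩
  -- `θ` is the volume fraction of a ball of radius `εr` in one of radius `2r`. A small ball missing
  -- `A` would push the density of `A` below `1 - θ`.
  set θ := ENNReal.ofReal ((ε / 2) ^ Module.finrank ℝ E) with hθ
  have hθ0 : θ ≠ 0 := by
    rw [hθ, ne_eq, ENNReal.ofReal_eq_zero, not_le]; positivity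
  have h1 : ∀ᶠ r in 𝓝[>] (0 : ℝ),
      1 - θ < μ (A ∩ Metric.closedBall x r) / μ (Metric.closedBall x r) :=
    h.eventually (lt_mem_nhds (ENNReal.sub_lt_self ENNReal.one_ne_top one_ne_zero hθ0))
  obtain ⟨δ, hδ, h2⟩ := mem_nhdsGT_iff_exists_Ioo_subset.1 h1
  have hδ0 : 0 < δ := hδ
  refine ⟨δ / 2, by linarith, fun r hr hrδ y hy => ?_⟩
  by_contra! hcon
  have h3 : 1 - θ < μ (A ∩ Metric.closedBall x (2 * r)) / μ (Metric.closedBall x (2 * r)) :=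
    h2 ⟨by linarith, by linarith⟩
  have hsub : Metric.closedBall y (ε * r) ⊆ Metric.closedBall x (2 * r) := by
    apply Metric.closedBall_subset_closedBall'
    rw [Metric.mem_closedBall] at hy
    nlinarith
  have hdisj : Disjoint (A ∩ Metric.closedBall x (2 * r)) (Metric.closedBall y (ε * r)) := by
    rw [Set.disjoint_left]
    rintro z ⟨hz, _⟩ hz'
    have := hcon z hz
    rw [Metric.mem_closedBall, dist_eq_norm] at hz'
    linarith
  have hvol : μ (Metric.closedBall y (ε * r)) = θ * μ (Metric.closedBall x (2 * r)) := by
    have he : ε * r = ε / 2 * (2 * r) := by ring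
    rw [he, Measure.addHaar_closedBall μ y (by positivity),
      Measure.addHaar_closedBall μ x (by positivity),
      hθ, mul_pow (ε / 2), ENNReal.ofReal_mul (by positivity), mul_assoc]
  have hsum : μ (A ∩ Metric.closedBall x (2 * r)) + θ * μ (Metric.closedBall x (2 * r)) ≤
      μ (Metric.closedBall x (2 * r)) := by
    rw [← hvol, ← measure_union hdisj Metric.isClosed_closedBall.measurableSet]
    exact measure_mono (union_subset inter_subset_right hsub)
  have hpos : μ (Metric.closedBall x (2 * r)) ≠ 0 :=
    (Metric.measure_closedBall_pos μ x (by linarith)).ne'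
  have hfin : μ (Metric.closedBall x (2 * r)) ≠ ⊤ := measure_closedBall_lt_top.ne
  have h4 : μ (A ∩ Metric.closedBall x (2 * r)) / μ (Metric.closedBall x (2 * r)) + θ ≤ 1 := by
    have := ENNReal.div_le_div_right hsum (μ (Metric.closedBall x (2 * r)))
    rwa [ENNReal.add_div, ENNReal.mul_div_cancel_right hpos hfin, ENNReal.div_self hpos hfin] at this
  exact absurd h3 (not_lt.2 (ENNReal.le_sub_of_add_le_right ENNReal.ofReal_ne_top h4))

/-- Differentiability within `A` says nothing at a point `y` outside `A`. Moving to a nearby `z ∈ A`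
costs only `‖T‖ ‖z - y‖`, so the linear model at `y` is still realised by `G z` up to `εr`. -/
lemma exists_mem_near_of_hasFDerivWithinAt {A : Set E} {x : E} {G : E → E} {T : E →L[ℝ] E}
    (hA : ∀ ε > 0, ∃ δ > 0, ∀ r, 0 < r → r < δ → ∀ y ∈ Metric.closedBall x r,
      ∃ z ∈ A, ‖z - y‖ ≤ ε * r)
    (hG : HasFDerivWithinAt G T A x) {ε : ℝ} (hε : 0 < ε) :
    ∃ δ > 0, ∀ r, 0 < r → r < δ → ∀ y ∈ Metric.closedBall x r,
      ∃ z ∈ A, ‖z - y‖ ≤ ε * r ∧ ‖G z - G x - T (y - x)‖ ≤ ε * r := by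
  set ε₁ := min (min 1 ε) (ε / (2 * (‖T‖ + 1))) with hε₁
  have hT := norm_nonneg T
  have hε₁0 : 0 < ε₁ := lt_min (lt_min one_pos hε) (by positivity)
  have hε₁1 : ε₁ ≤ 1 := (min_le_left _ _).trans (min_le_left _ _)
  have hε₁2 : ε₁ ≤ ε := (min_le_left _ _).trans (min_le_right _ _)
  have hε₁3 : ‖T‖ * ε₁ ≤ ε / 2 := by
    have : ε₁ ≤ ε / (2 * (‖T‖ + 1)) := min_le_right _ _
    rw [le_div_iff₀ (by positivity)] at this
    nlinarith
  have h1 := (hasFDerivWithinAt_iff_isLittleO.1 hG).def (c := ε / 4) (by positivity)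
  obtain ⟨δ₁, hδ₁, h2⟩ := Metric.mem_nhdsWithin_iff.1 h1
  obtain ⟨δ₂, hδ₂, h3⟩ := hA ε₁ hε₁0
  refine ⟨min (δ₁ / 2) δ₂, lt_min (by linarith) hδ₂, fun r hr hrδ y hy => ?_⟩
  obtain ⟨z, hz, hzy⟩ := h3 r hr (hrδ.trans_le (min_le_right _ _)) y hy
  rw [Metric.mem_closedBall, dist_eq_norm] at hy
  have hzx : ‖z - x‖ ≤ 2 * r := by
    have : z - x = (z - y) + (y - x) := by abel
    rw [this]
    have := norm_add_le (z - y) (y - x)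
    nlinarith
  have hr1 : r < δ₁ / 2 := hrδ.trans_le (min_le_left _ _)
  have h4 : ‖G z - G x - T (z - x)‖ ≤ ε / 4 * ‖z - x‖ :=
    h2 ⟨by rw [Metric.mem_ball, dist_eq_norm]; linarith, hz⟩
  refine ⟨z, hz, hzy.trans (by gcongr), ?_⟩
  have h5 : G z - G x - T (y - x) = (G z - G x - T (z - x)) + T (z - y) := by
    simp only [map_sub]; abel
  have h6 : ‖T (z - y)‖ ≤ ‖T‖ * (ε₁ * r) := (T.le_opNorm _).trans (by gcongr)
  rw [h5]
  refine (norm_add_le _ _).trans ?_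
  have h7 : ‖T‖ * ε₁ * r ≤ ε / 2 * r := by gcongr
  have h8 : ε / 4 * ‖z - x‖ ≤ ε / 4 * (2 * r) := by gcongr
  linarith

/-- Summing first order lower bounds along a subdivided segment gives a second order one. -/
lemma second_order_of_first_order {x : E} {T : E →L[ℝ] E} {W : E → ℝ} {r c : ℝ}
    (h : ∀ a ∈ Metric.closedBall x r, ∀ b ∈ Metric.closedBall x r,
      inner ℝ (T (a - x)) (b - a) - c ≤ W b - W a) {N : ℕ} (hN : 0 < N)
    {a b : E} (ha : a ∈ Metric.closedBall x r) (hb : b ∈ Metric.closedBall x r) :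
    inner ℝ (T (a - x)) (b - a) + 1 / 2 * inner ℝ (T (b - a)) (b - a)
      - (2 * ‖T‖ * r ^ 2 / N + N * c) ≤ W b - W a := by
  have hN' : (0 : ℝ) < N := by exact_mod_cast hN
  set y : ℕ → E := fun j => a + ((j : ℝ) / N) • (b - a) with hy
  have hmem : ∀ j, j ≤ N → y j ∈ Metric.closedBall x r := by
    intro j hj
    have hj' : (j : ℝ) ≤ N := by exact_mod_cast hj
    exact (convex_closedBall x r).add_smul_sub_mem ha hb
      ⟨by positivity, (div_le_one hN').2 hj'⟩
  -- The slope grows linearly along the segment, and the sum of `i / N²` over `i < j` is `j (j - 1)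
  -- / (2 N²)`. At `j = N` this is `1/2 - 1/(2N)`; the defect gives the error `2‖T‖r²/N`.
  have hind : ∀ j, j ≤ N → (j : ℝ) / N * inner ℝ (T (a - x)) (b - a)
      + (j : ℝ) * (j - 1) / (2 * (N : ℝ) ^ 2) * inner ℝ (T (b - a)) (b - a) - j * c
      ≤ W (y j) - W a := by
    intro j
    induction j with
    | zero => intro _; simp [hy]
    | succ j ih =>
      intro hj
      have h1 := ih (by omega)
      have h2 := h _ (hmem j (by omega)) _ (hmem (j + 1) hj)
      have h3 : y (j + 1) - y j = (1 / (N : ℝ)) • (b - a) := by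
        simp only [hy]
        rw [add_sub_add_left_eq_sub, ← sub_smul]
        congr 1
        push_cast; ring
      have h4 : y j - x = (a - x) + ((j : ℝ) / N) • (b - a) := by simp only [hy]; abel
      rw [h3, h4, map_add, map_smul, real_inner_smul_right, inner_add_left,
        real_inner_smul_left] at h2
      push_cast
      have h5 : ((j : ℝ) + 1) / N * inner ℝ (T (a - x)) (b - a)
          + ((j : ℝ) + 1) * (j + 1 - 1) / (2 * (N : ℝ) ^ 2) * inner ℝ (T (b - a)) (b - a)
          - (j + 1) * c = ((j : ℝ) / N * inner ℝ (T (a - x)) (b - a)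
          + (j : ℝ) * (j - 1) / (2 * (N : ℝ) ^ 2) * inner ℝ (T (b - a)) (b - a) - j * c)
          + (1 / (N : ℝ) * (inner ℝ (T (a - x)) (b - a)
          + (j : ℝ) / N * inner ℝ (T (b - a)) (b - a)) - c) := by
        field_simp; ring
      linarith
  have hfin := hind N le_rfl
  have hyN : y N = b := by simp only [hy, div_self hN'.ne', one_smul]; abel
  rw [hyN, div_self hN'.ne', one_mul] at hfin
  have h6 : (N : ℝ) * (N - 1) / (2 * (N : ℝ) ^ 2) = 1 / 2 - 1 / (2 * N) := by
    field_simp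
  rw [h6] at hfin
  have hba : ‖b - a‖ ≤ 2 * r := by
    rw [Metric.mem_closedBall, dist_eq_norm] at ha hb
    have : b - a = (b - x) - (a - x) := by abel
    rw [this]
    exact (norm_sub_le _ _).trans (by linarith)
  have h7 : inner ℝ (T (b - a)) (b - a) ≤ ‖T‖ * (4 * r ^ 2) := by
    refine (real_inner_le_norm _ _).trans ?_
    calc ‖T (b - a)‖ * ‖b - a‖ ≤ ‖T‖ * ‖b - a‖ * ‖b - a‖ := by
          gcongr; exact T.le_opNorm _
      _ = ‖T‖ * ‖b - a‖ ^ 2 := by ring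
      _ ≤ ‖T‖ * (2 * r) ^ 2 := by gcongr
      _ = ‖T‖ * (4 * r ^ 2) := by ring
  have h8 : 1 / (2 * (N : ℝ)) * inner ℝ (T (b - a)) (b - a) ≤ 2 * ‖T‖ * r ^ 2 / N := by
    calc 1 / (2 * (N : ℝ)) * inner ℝ (T (b - a)) (b - a)
        ≤ 1 / (2 * (N : ℝ)) * (‖T‖ * (4 * r ^ 2)) := by gcongr
      _ = 2 * ‖T‖ * r ^ 2 / N := by field_simp; ring
  linarith

variable {D A : Set E} {v : E → ℝ} {G : E → E} {T : E →L[ℝ] E} {x : E}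

/-- If the slope map `G` of `v` on `A` has derivative `T` at `x` and `A` is dense enough near `x`,
then there is a function `W` satisfying approximate second order inequalities and lying
approximately below `v` minus its touching affine function. -/
lemma exists_quadratic_comparison (hAD : A ⊆ D) (hG : ∀ z ∈ A, IsSlope D v z (G z)) (hx : x ∈ D)
    (hA : ∀ ε > 0, ∃ δ > 0, ∀ r, 0 < r → r < δ → ∀ y ∈ Metric.closedBall x r,
      ∃ z ∈ A, ‖z - y‖ ≤ ε * r ∧ ‖G z - G x - T (y - x)‖ ≤ ε * r)
    (hGx : IsSlope D v x (G x)) {η : ℝ} (hη : 0 < η) :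
    ∃ δ > 0, ∀ r, 0 < r → r < δ → ∃ W : E → ℝ, 0 ≤ W x ∧
      (∀ a ∈ Metric.closedBall x r, ∀ b ∈ Metric.closedBall x r,
        inner ℝ (T (a - x)) (b - a) + 1 / 2 * inner ℝ (T (b - a)) (b - a) - η * r ^ 2
          ≤ W b - W a) ∧
      (∀ b ∈ Metric.closedBall x r, W b ≤ inner ℝ (T (b - x)) (b - x) + η * r ^ 2) ∧
      (∀ b ∈ Metric.closedBall x r, b ∈ D →
        W b - η * r ^ 2 ≤ v b - v x - inner ℝ (G x) (b - x)) := by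
  have hT := norm_nonneg T
  obtain ⟨N, hN⟩ := exists_nat_gt (4 * ‖T‖ / η)
  have hN0 : (0 : ℝ) < N := lt_of_le_of_lt (by positivity) hN
  have hN1 : (1 : ℝ) ≤ N := by
    have : 0 < N := by exact_mod_cast hN0
    exact_mod_cast this
  -- `N` is fixed first, to control the discretisation error. `ε` follows, since the error of each
  -- of the `N` steps accumulates.
  obtain ⟨ε, hε0, hε1, hεη⟩ : ∃ ε : ℝ, 0 < ε ∧ ε ≤ 1 ∧ N * ((4 + 2 * ‖T‖) * ε) ≤ η / 2 := by
    refine ⟨min 1 (η / (2 * N * (4 + 2 * ‖T‖))), lt_min one_pos (by positivity),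
      min_le_left _ _, ?_⟩
    have := min_le_right 1 (η / (2 * N * (4 + 2 * ‖T‖)))
    rw [le_div_iff₀ (by positivity)] at this
    linarith
  have hε2 : (4 + 2 * ‖T‖) * ε ≤ η / 2 := by
    have : 0 ≤ (4 + 2 * ‖T‖) * ε := by positivity
    nlinarith
  obtain ⟨δ, hδ, hδA⟩ := hA ε hε0
  refine ⟨δ, hδ, fun r hr hrδ => ?_⟩
  have hch : ∀ y : E, ∃ z : E, y ∈ Metric.closedBall x r →
      z ∈ A ∧ ‖z - y‖ ≤ ε * r ∧ ‖G z - G x - T (y - x)‖ ≤ ε * r := by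
    intro y
    by_cases hy : y ∈ Metric.closedBall x r
    · obtain ⟨z, hz⟩ := hδA r hr hrδ y hy
      exact ⟨z, fun _ => hz⟩
    · exact ⟨y, fun h => absurd h hy⟩
  choose Z hZ using hch
  set w : E → ℝ := fun y => v y - v x - inner ℝ (G x) (y - x) with hw
  have hwx : w x = 0 := by simp [hw]
  have hw0 : ∀ y ∈ D, 0 ≤ w y := fun y hy => by have := hGx y hy; simp only [hw]; linarith
  have hww : ∀ z ∈ A, ∀ y ∈ D, w z + inner ℝ (G z - G x) (y - z) ≤ w y := by
    intro z hz y hy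
    have h1 := hG z hz y hy
    have h2 : inner ℝ (G x) (y - x) = inner ℝ (G x) (z - x) + inner ℝ (G x) (y - z) := by
      rw [← inner_add_right]; congr 1; abel
    simp only [hw, inner_sub_left, h2]
    linarith
  have hxr : x ∈ Metric.closedBall x r := Metric.mem_closedBall_self hr.le
  -- comparison of the exact increments with those of the linear model
  have hinc : ∀ a ∈ Metric.closedBall x r, ∀ g h : E, ‖g‖ ≤ 4 * r → ‖h - g‖ ≤ 2 * (ε * r) →
      inner ℝ (T (a - x)) h - (4 + 2 * ‖T‖) * ε * r ^ 2 ≤ inner ℝ (G (Z a) - G x) g := by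
    intro a ha g h hg hgh
    obtain ⟨_, _, h3⟩ := hZ a ha
    rw [Metric.mem_closedBall, dist_eq_norm] at ha
    have e1 : inner ℝ (G (Z a) - G x) g = inner ℝ (T (a - x)) h
        + inner ℝ (G (Z a) - G x - T (a - x)) g - inner ℝ (T (a - x)) (h - g) := by
      simp only [inner_sub_left, inner_sub_right]; ring
    have e2 : |inner ℝ (G (Z a) - G x - T (a - x)) g| ≤ ε * r * (4 * r) :=
      (abs_real_inner_le_norm _ _).trans (by gcongr)
    have e3 : |inner ℝ (T (a - x)) (h - g)| ≤ ‖T‖ * r * (2 * (ε * r)) := by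
      refine (abs_real_inner_le_norm _ _).trans ?_
      have : ‖T (a - x)‖ ≤ ‖T‖ * r := (T.le_opNorm _).trans (by gcongr)
      gcongr
    rw [abs_le] at e2 e3
    rw [e1]
    nlinarith [e2.1, e3.2]
  have hεr : ε * r ≤ r := by nlinarith
  have hηr : (4 + 2 * ‖T‖) * ε * r ^ 2 ≤ η * r ^ 2 := by gcongr; linarith
  have hstep : ∀ a ∈ Metric.closedBall x r, ∀ b ∈ Metric.closedBall x r,
      inner ℝ (T (a - x)) (b - a) - (4 + 2 * ‖T‖) * ε * r ^ 2 ≤ w (Z b) - w (Z a) := by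
    intro a ha b hb
    obtain ⟨ha1, ha2, _⟩ := hZ a ha
    obtain ⟨hb1, hb2, _⟩ := hZ b hb
    have h1 := hww _ ha1 _ (hAD hb1)
    have hd : ‖(b - a) - (Z b - Z a)‖ ≤ 2 * (ε * r) := by
      have : (b - a) - (Z b - Z a) = (Z a - a) - (Z b - b) := by abel
      rw [this]
      exact (norm_sub_le _ _).trans (by linarith)
    have hd2 : ‖Z b - Z a‖ ≤ 4 * r := by
      have : Z b - Z a = (Z b - b) + (b - x) - (a - x) - (Z a - a) := by abel
      rw [Metric.mem_closedBall, dist_eq_norm] at ha hb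
      rw [this]
      have i1 := norm_sub_le ((Z b - b) + (b - x) - (a - x)) (Z a - a)
      have i2 := norm_sub_le ((Z b - b) + (b - x)) (a - x)
      have i3 := norm_add_le (Z b - b) (b - x)
      linarith
    have h2 := hinc a ha (Z b - Z a) (b - a) hd2 hd
    linarith
  -- `W` samples `w` at a point of `A` near `y`. The three inequalities use the touching plane at
  -- that sample point, evaluated at another sample point, at `x`, and at `b` itself.
  refine ⟨fun y => w (Z y), hw0 _ (hAD (hZ x hxr).1), ?_, ?_, ?_⟩
  · intro a ha b hb
    have h1 := second_order_of_first_order hstep (N := N) (by exact_mod_cast hN0) ha hb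
    refine le_trans ?_ h1
    have h2 : 2 * ‖T‖ * r ^ 2 / N ≤ η / 2 * r ^ 2 := by
      rw [div_lt_iff₀ hη] at hN
      rw [div_le_iff₀ hN0]
      nlinarith [sq_nonneg r]
    have h3 : N * ((4 + 2 * ‖T‖) * ε * r ^ 2) ≤ η / 2 * r ^ 2 := by
      calc N * ((4 + 2 * ‖T‖) * ε * r ^ 2) = N * ((4 + 2 * ‖T‖) * ε) * r ^ 2 := by ring
        _ ≤ η / 2 * r ^ 2 := by gcongr
    linarith
  · intro b hb
    obtain ⟨hb1, hb2, _⟩ := hZ b hb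
    have h1 := hww _ hb1 x hx
    rw [hwx] at h1
    rw [norm_sub_rev] at hb2
    have e1 : (x - b) - (x - Z b) = -(b - Z b) := by abel
    have e2 : x - Z b = (x - b) + (b - Z b) := by abel
    have hb' := hb
    rw [Metric.mem_closedBall', dist_eq_norm] at hb'
    have h2 := hinc b hb (x - Z b) (x - b)
      (by rw [e2]; exact (norm_add_le _ _).trans (by linarith))
      (by rw [e1, norm_neg]; linarith [norm_nonneg (b - Z b)])
    have h3 : inner ℝ (T (b - x)) (x - b) = -inner ℝ (T (b - x)) (b - x) := by
      rw [← inner_neg_right]; congr 1; abel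
    rw [h3] at h2
    show w (Z b) ≤ _
    linarith
  · intro b hb hbD
    obtain ⟨hb1, hb2, _⟩ := hZ b hb
    have h1 := hww _ hb1 b hbD
    rw [norm_sub_rev] at hb2
    have h2 := hinc b hb (b - Z b) 0 (by linarith)
      (by rw [zero_sub, norm_neg]; linarith [norm_nonneg (b - Z b)])
    rw [inner_zero_right] at h2
    show w (Z b) - _ ≤ w b
    linarith

lemma le_of_forall_pos_le_mul {a C : ℝ} (h : ∀ η > 0, a ≤ C * η) : a ≤ 0 := by
  by_contra! ha
  have h1 := h (a / (2 * (|C| + 1))) (by positivity)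
  have h2 : C * (a / (2 * (|C| + 1))) ≤ |C| * (a / (2 * (|C| + 1))) := by
    gcongr; exact le_abs_self C
  have h3 : |C| * (a / (2 * (|C| + 1))) ≤ a / 2 := by
    rw [mul_div_assoc', div_le_div_iff₀ (by positivity) (by positivity)]
    nlinarith [abs_nonneg C]
  linarith

/-- The derivative of the slope map at a density point is symmetric, positive semidefinite, and
is a second order subderivative of `v`. -/
lemma fderiv_slope (hAD : A ⊆ D) (hG : ∀ z ∈ A, IsSlope D v z (G z)) (hx : x ∈ A)
    (hA : ∀ ε > 0, ∃ δ > 0, ∀ r, 0 < r → r < δ → ∀ y ∈ Metric.closedBall x r,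
      ∃ z ∈ A, ‖z - y‖ ≤ ε * r)
    (hT : HasFDerivWithinAt G T A x) (hD : D ∈ 𝓝 x) :
    (∀ a b, inner ℝ (T a) b = inner ℝ (T b) a) ∧ (∀ a, 0 ≤ inner ℝ (T a) a) ∧
      ∀ ε > 0, ∀ᶠ y in 𝓝 x, v x + inner ℝ (G x) (y - x) + 1 / 2 * inner ℝ (T (y - x)) (y - x)
        - ε * ‖y - x‖ ^ 2 ≤ v y := by
  have hcmp := fun η (hη : η > 0) => exists_quadratic_comparison hAD hG (hAD hx)
    (fun ε hε => exists_mem_near_of_hasFDerivWithinAt hA hT hε) (hG x hx) hη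
  have hball : ∀ a : E, ∀ r > 0, ‖a‖ ≤ r → x + a ∈ Metric.closedBall x r := by
    intro a r _ ha; rwa [Metric.mem_closedBall, dist_eq_norm, add_sub_cancel_left]
  have hsymm : ∀ a b, inner ℝ (T a) b ≤ inner ℝ (T b) a := by
    intro a b
    set R := ‖a‖ + ‖b‖ + 1 with hR
    have hR0 : 0 < R := by positivity
    rw [← sub_nonpos]
    refine le_of_forall_pos_le_mul (C := 6 * R ^ 2) fun η hη => ?_
    obtain ⟨δ, hδ, h⟩ := hcmp η hη
    obtain ⟨t, ht0, ht⟩ : ∃ t > 0, t * R < δ := ⟨δ / (2 * R), by positivity, by field_simp; norm_num⟩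
    obtain ⟨W, -, h1, -, -⟩ := h (t * R) (by positivity) ht
    have hxr : x ∈ Metric.closedBall x (t * R) := Metric.mem_closedBall_self (by positivity)
    have har : x + t • a ∈ Metric.closedBall x (t * R) := hball _ _ (by positivity) (by
      rw [norm_smul, Real.norm_of_nonneg ht0.le]; gcongr; linarith [norm_nonneg b])
    have hbr : x + t • b ∈ Metric.closedBall x (t * R) := hball _ _ (by positivity) (by
      rw [norm_smul, Real.norm_of_nonneg ht0.le]; gcongr; linarith [norm_nonneg a])
    -- The increments of `W` around the triangle `x`, `x + ta`, `x + tb` sum to zero. The second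
    -- order terms leave `t²/2` times the antisymmetric part of `T`, and the three errors give `6 R²
    -- η`.
    have k1 := h1 x hxr _ har
    have k2 := h1 _ har _ hbr
    have k3 := h1 _ hbr x hxr
    have e1 : x + t • b - (x + t • a) = t • b - t • a := by abel
    have e2 : x - (x + t • b) = -(t • b) := by abel
    simp only [add_sub_cancel_left, sub_self, map_zero, inner_zero_left, e1, e2, map_sub, map_smul,
      map_neg, inner_sub_left, inner_sub_right, real_inner_smul_left, real_inner_smul_right,
      inner_neg_left, inner_neg_right] at k1 k2 k3
    have k4 : t ^ 2 * (inner ℝ (T a) b - inner ℝ (T b) a) ≤ t ^ 2 * (6 * R ^ 2 * η) := by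
      nlinarith
    exact le_of_mul_le_mul_left k4 (by positivity)
  refine ⟨fun a b => le_antisymm (hsymm a b) (hsymm b a), fun a => ?_, fun ε hε => ?_⟩
  · rw [← neg_nonpos]
    set R := ‖a‖ + 1 with hR
    have hR0 : 0 < R := by positivity
    refine le_of_forall_pos_le_mul (C := 4 * R ^ 2) fun η hη => ?_
    obtain ⟨δ, hδ, h⟩ := hcmp η hη
    obtain ⟨t, ht0, ht⟩ : ∃ t > 0, t * R < δ := ⟨δ / (2 * R), by positivity, by field_simp; norm_num⟩
    obtain ⟨W, h0, h1, h2, -⟩ := h (t * R) (by positivity) ht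
    have hxr : x ∈ Metric.closedBall x (t * R) := Metric.mem_closedBall_self (by positivity)
    have har : x + t • a ∈ Metric.closedBall x (t * R) := hball _ _ (by positivity) (by
      rw [norm_smul, Real.norm_of_nonneg ht0.le]; gcongr; linarith)
    -- The lower bound carries `1/2 ⟨Ta, a⟩` and the upper bound carries `⟨Ta, a⟩`; they are
    -- compatible only if this quantity is nonnegative up to the error.
    have k1 := h1 x hxr _ har
    have k2 := h2 _ har
    simp only [add_sub_cancel_left, sub_self, map_zero, inner_zero_left, map_smul,
      real_inner_smul_left, real_inner_smul_right] at k1 k2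
    have k4 : t ^ 2 * -inner ℝ (T a) a ≤ t ^ 2 * (4 * R ^ 2 * η) := by nlinarith
    exact le_of_mul_le_mul_left k4 (by positivity)
  · obtain ⟨δ, hδ, h⟩ := hcmp (ε / 2) (by positivity)
    filter_upwards [hD, Metric.ball_mem_nhds x hδ] with y hyD hy
    rcases eq_or_ne y x with rfl | hyx
    · simp
    rw [Metric.mem_ball, dist_eq_norm] at hy
    obtain ⟨W, h0, h1, -, h3⟩ := h ‖y - x‖ (norm_pos_iff.2 (sub_ne_zero.2 hyx)) hy
    have hyr : y ∈ Metric.closedBall x ‖y - x‖ := by rw [Metric.mem_closedBall, dist_eq_norm]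
    have k1 := h1 x (Metric.mem_closedBall_self (norm_nonneg _)) y hyr
    have k3 := h3 y hyr hyD
    simp only [sub_self, map_zero, inner_zero_left] at k1
    linarith

end

/-! ### Jacobian bound and change of variables -/

lemma det_le_trace_pow {n : ℕ} {X : Matrix (Fin n) (Fin n) ℝ} (hX : X.PosSemidef) :
    X.det ≤ X.trace ^ n := by
  have hev := hX.eigenvalues_nonneg
  rw [hX.isHermitian.det_eq_prod_eigenvalues, hX.isHermitian.trace_eq_sum_eigenvalues]
  simp only [RCLike.ofReal_real_eq_id, id_eq]
  calc ∏ i, hX.isHermitian.eigenvalues i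
      ≤ ∏ _i : Fin n, ∑ j, hX.isHermitian.eigenvalues j := by
        refine Finset.prod_le_prod (fun i _ => hev i) fun i _ => ?_
        exact Finset.single_le_sum (f := hX.isHermitian.eigenvalues) (fun j _ => hev j)
          (Finset.mem_univ i)
    _ = _ := by simp

lemma exists_matrix_of_clm {n : ℕ}
    (T : EuclideanSpace ℝ (Fin n) →L[ℝ] EuclideanSpace ℝ (Fin n)) :
    ∃ X : Matrix (Fin n) (Fin n) ℝ, T.det = X.det ∧
      ∀ a b : EuclideanSpace ℝ (Fin n), b.ofLp ⬝ᵥ X.mulVec a.ofLp = inner ℝ (T a) b := by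
  refine ⟨LinearMap.toMatrix (EuclideanSpace.basisFun (Fin n) ℝ).toBasis
    (EuclideanSpace.basisFun (Fin n) ℝ).toBasis T, ?_, fun a b => ?_⟩
  · rw [LinearMap.det_toMatrix]
  · have h := LinearMap.toMatrix_mulVec_repr (EuclideanSpace.basisFun (Fin n) ℝ).toBasis
      (EuclideanSpace.basisFun (Fin n) ℝ).toBasis (T : EuclideanSpace ℝ (Fin n) →ₗ[ℝ] _) a
    have h1 : ∀ c : EuclideanSpace ℝ (Fin n),
        ((EuclideanSpace.basisFun (Fin n) ℝ).toBasis.repr c : Fin n → ℝ) = c.ofLp := by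
      intro c; ext i; simp
    rw [h1, h1] at h
    rw [h, EuclideanSpace.inner_eq_star_dotProduct]
    simp

/-- By `fderiv_slope` the derivative is a positive semidefinite subjet matrix. The convex bound
therefore controls its trace, and `det_le_trace_pow` its determinant. -/
lemma det_fderiv_slope_le {n : ℕ} {d m M lam : ℝ}
    {v s f : EuclideanSpace ℝ (Fin n) → ℝ} (hv : IsWell d m v) (hlam : 0 < lam)
    (hb : HasConvexBound M lam s f v) {A : Set (EuclideanSpace ℝ (Fin n))}
    {G : EuclideanSpace ℝ (Fin n) → EuclideanSpace ℝ (Fin n)}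
    (hA : ∀ x ∈ A, v x < 0)
    (hG : ∀ x ∈ A, IsSlope (Metric.closedBall 0 (2 * d)) v x (G x))
    (hGM : ∀ x ∈ A, M ≤ ‖G x‖ ∧ G x ≠ 0) {x : EuclideanSpace ℝ (Fin n)} (hx : x ∈ A)
    (hdens : ∀ ε > 0, ∃ δ > 0, ∀ r, 0 < r → r < δ → ∀ y ∈ Metric.closedBall x r,
      ∃ z ∈ A, ‖z - y‖ ≤ ε * r)
    {T : EuclideanSpace ℝ (Fin n) →L[ℝ] EuclideanSpace ℝ (Fin n)}
    (hT : HasFDerivWithinAt G T A x) :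
    |T.det| ≤ ((s x * ‖G x‖ + f x) / lam) ^ n := by
  have hd := hv.d_pos
  have hsub : Metric.ball (0 : EuclideanSpace ℝ (Fin n)) d ⊆ Metric.closedBall 0 (2 * d) :=
    (Metric.ball_subset_ball (by linarith)).trans Metric.ball_subset_closedBall
  obtain ⟨hsymm, hpos, hexp⟩ := fderiv_slope (fun z hz => hsub (hv.mem_ball z (hA z hz))) hG hx
    hdens hT (mem_of_superset (Metric.isOpen_ball.mem_nhds (hv.mem_ball x (hA x hx))) hsub)
  obtain ⟨X, hdet, hX⟩ := exists_matrix_of_clm T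
  have hXs : X.IsSymm := by
    ext i j
    have h1 := hX (EuclideanSpace.single i 1) (EuclideanSpace.single j 1)
    have h2 := hX (EuclideanSpace.single j 1) (EuclideanSpace.single i 1)
    rw [hsymm, ← h2] at h1
    simpa using h1
  have hXp : X.PosSemidef := by
    refine Matrix.PosSemidef.of_dotProduct_mulVec_nonneg ?_ fun a => ?_
    · rw [Matrix.IsHermitian, Matrix.conjTranspose_eq_transpose_of_trivial]; exact hXs
    · have := hX (WithLp.toLp 2 a) (WithLp.toLp 2 a)
      simp only [star_trivial]
      rw [this]
      exact hpos _
  have hsj : (G x, X) ∈ subjet v x := by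
    refine ⟨hXs, fun ε hε => ?_⟩
    filter_upwards [hexp ε hε] with y hy
    simp only [hX]
    exact hy
  have h1 := hb x (hA x hx) _ hsj (hGM x hx).1 (hGM x hx).2 hXp
  have htr : X.trace ≤ (s x * ‖G x‖ + f x) / lam := by
    rw [le_div_iff₀ hlam, mul_comm]; exact h1
  rw [hdet, abs_of_nonneg hXp.det_nonneg]
  exact (det_le_trace_pow hXp).trans (pow_le_pow_left₀ hXp.trace_nonneg htr n)

/-- Lipschitz maps distort Hausdorff measure by at most a constant factor, and in top dimension it
has the same null sets as Haar measure. -/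
lemma measure_image_eq_zero_of_lipschitzOnWith {E : Type*} [NormedAddCommGroup E]
    [NormedSpace ℝ E] [FiniteDimensional ℝ E] [MeasurableSpace E] [BorelSpace E] (μ : Measure E)
    [μ.IsAddHaarMeasure] {L : NNReal} {G : E → E} {A : Set E} (hG : LipschitzOnWith L G A)
    (hA : μ A = 0) : μ (G '' A) = 0 := by
  have h1 : μH[(Module.finrank ℝ E : ℝ)] A = 0 :=
    Measure.absolutelyContinuous_isAddHaarMeasure μH[(Module.finrank ℝ E : ℝ)] μ hA
  have h2 := hG.hausdorffMeasure_image_le (d := (Module.finrank ℝ E : ℝ)) (by positivity)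
  rw [h1, mul_zero, nonpos_iff_eq_zero] at h2
  exact Measure.absolutelyContinuous_isAddHaarMeasure μ μH[(Module.finrank ℝ E : ℝ)] h2

/-- Rademacher's theorem and Lebesgue density hold at almost every point of `A`, and the exceptional
null set has null image. Derivatives are taken within the larger set `A`, so only the density of `A`
matters. -/
lemma volume_image_slope_le {n : ℕ} {d m M lam : ℝ}
    {v s f : EuclideanSpace ℝ (Fin n) → ℝ} (hv : IsWell d m v) (hlam : 0 < lam)
    (hb : HasConvexBound M lam s f v) {A B : Set (EuclideanSpace ℝ (Fin n))}
    {G : EuclideanSpace ℝ (Fin n) → EuclideanSpace ℝ (Fin n)}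
    (hA : ∀ x ∈ A, v x < 0)
    (hG : ∀ x ∈ A, IsSlope (Metric.closedBall 0 (2 * d)) v x (G x))
    (hGM : ∀ x ∈ A, M ≤ ‖G x‖ ∧ G x ≠ 0) {L : NNReal} (hL : LipschitzOnWith L G A)
    (hAm : MeasurableSet A) (hBm : MeasurableSet B) (hBA : B ⊆ A) :
    volume (G '' B) ≤ ∫⁻ x in B, ENNReal.ofReal (((s x * ‖G x‖ + f x) / lam) ^ n) := by
  have hae : ∀ᵐ x ∂volume, x ∈ A → DifferentiableWithinAt ℝ G A x ∧
      Tendsto (fun r => volume (A ∩ Metric.closedBall x r) / volume (Metric.closedBall x r))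
        (𝓝[>] 0) (𝓝 1) := by
    have h2 := (ae_restrict_iff' hAm).1 (Besicovitch.ae_tendsto_measure_inter_div volume A)
    filter_upwards [hL.ae_differentiableWithinAt_of_mem (μ := volume), h2] with x h1 h2 hx
    exact ⟨h1 hx, h2 hx⟩
  set N := toMeasurable volume {x | ¬ (x ∈ A → DifferentiableWithinAt ℝ G A x ∧
      Tendsto (fun r => volume (A ∩ Metric.closedBall x r) / volume (Metric.closedBall x r))
        (𝓝[>] 0) (𝓝 1))} with hN
  have hN0 : volume N = 0 := by rw [hN, measure_toMeasurable]; exact hae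
  have hNm : MeasurableSet N := measurableSet_toMeasurable _ _
  have hgood : ∀ x ∈ B \ N, DifferentiableWithinAt ℝ G A x ∧
      Tendsto (fun r => volume (A ∩ Metric.closedBall x r) / volume (Metric.closedBall x r))
        (𝓝[>] 0) (𝓝 1) := by
    intro x hx
    by_contra hcon
    exact hx.2 (subset_toMeasurable _ _ fun h => hcon (h (hBA hx.1)))
  have h1 : volume (G '' (B ∩ N)) = 0 :=
    measure_image_eq_zero_of_lipschitzOnWith volume
      (hL.mono (inter_subset_left.trans hBA)) (measure_mono_null inter_subset_right hN0)
  have h2 : volume (G '' (B \ N)) ≤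
      ∫⁻ x in B \ N, ENNReal.ofReal |(fderivWithin ℝ G A x).det| := by
    refine addHaar_image_le_lintegral_abs_det_fderiv volume (hBm.diff hNm) fun x hx => ?_
    exact (hgood x hx).1.hasFDerivWithinAt.mono (sdiff_subset.trans hBA)
  calc volume (G '' B) ≤ volume (G '' (B ∩ N)) + volume (G '' (B \ N)) := by
        rw [← inter_union_sdiff B N, image_union, inter_union_sdiff]
        exact measure_union_le _ _
    _ ≤ ∫⁻ x in B \ N, ENNReal.ofReal |(fderivWithin ℝ G A x).det| := by rw [h1, zero_add]; exact h2
    _ ≤ ∫⁻ x in B \ N, ENNReal.ofReal (((s x * ‖G x‖ + f x) / lam) ^ n) := by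
        refine setLIntegral_mono' (hBm.diff hNm) fun x hx => ENNReal.ofReal_le_ofReal ?_
        exact det_fderiv_slope_le hv hlam hb hA hG hGM (hBA hx.1)
          (fun ε hε => exists_mem_near_of_density (hgood x hx).2 hε)
          (hgood x hx).1.hasFDerivWithinAt
    _ ≤ _ := lintegral_mono_set sdiff_subset

/-! ### Summation over dyadic annuli of slopes -/

lemma pow_mul_volume_ball_le_annulus {n : ℕ} (hn : 1 ≤ n) {ρ : ℝ} (hρ : 0 < ρ) :
    ENNReal.ofReal (ρ ^ n) * volume (Metric.ball (0 : EuclideanSpace ℝ (Fin n)) 1) ≤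
      volume (Metric.closedBall (0 : EuclideanSpace ℝ (Fin n)) (2 * ρ) \ Metric.closedBall 0 ρ) := by
  set ω := volume (Metric.ball (0 : EuclideanSpace ℝ (Fin n)) 1) with hω
  have hωfin : ω ≠ ⊤ := measure_ball_lt_top.ne
  have h1 : volume (Metric.closedBall (0 : EuclideanSpace ℝ (Fin n)) (2 * ρ)) ≤
      volume (Metric.closedBall (0 : EuclideanSpace ℝ (Fin n)) (2 * ρ) \ Metric.closedBall 0 ρ)
        + volume (Metric.closedBall (0 : EuclideanSpace ℝ (Fin n)) ρ) := by
    refine (measure_mono ?_).trans (measure_union_le _ _)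
    rw [sdiff_union_self]
    exact subset_union_left
  rw [Measure.addHaar_closedBall _ _ (by positivity), Measure.addHaar_closedBall _ _ hρ.le,
    finrank_euclideanSpace_fin, ← hω] at h1
  have h2 : ENNReal.ofReal (ρ ^ n) * ω + ENNReal.ofReal (ρ ^ n) * ω ≤
      ENNReal.ofReal ((2 * ρ) ^ n) * ω := by
    rw [← add_mul, ← ENNReal.ofReal_add (by positivity) (by positivity)]
    gcongr
    have : (2 : ℝ) ^ 1 ≤ 2 ^ n := pow_le_pow_right₀ (by norm_num) hn
    rw [mul_pow]
    nlinarith [pow_pos hρ n]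
  exact (ENNReal.add_le_add_iff_right (ENNReal.mul_ne_top ENNReal.ofReal_ne_top hωfin)).1
    (h2.trans h1)

set_option maxHeartbeats 800000 in
/-- If the depth of the well exceeds `3 d 2 ^ N r`, with `r` larger than `M` and the `L ^ n` norm
of `f` on the touching set, then `N` is controlled by the `L ^ n` norm of `s`. -/
lemma mul_volume_ball_le {n : ℕ} (hn : 1 ≤ n) {d m M lam r S : ℝ} {N : ℕ}
    {v s f : EuclideanSpace ℝ (Fin n) → ℝ} (hv : IsWell d m v) (hlam : 0 < lam)
    (hs : ContinuousOn s (Metric.ball 0 d)) (hf : ContinuousOn f (Metric.ball 0 d))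
    (hs0 : ∀ x, 0 ≤ s x) (hf0 : ∀ x, 0 ≤ f x)
    (hb : HasConvexBound M lam s f v) (hM : 0 ≤ M) (hr : M < r) (hN : 3 * d * (2 ^ N * r) < m)
    (hS : 0 ≤ S)
    (hsS : ∫⁻ x in Metric.ball 0 d, ENNReal.ofReal (s x ^ n) ≤ ENNReal.ofReal (S ^ n))
    {Q : Set (EuclideanSpace ℝ (Fin n))}
    (hQ : ∀ x p, v x < 0 → IsSlope (Metric.closedBall 0 (2 * d)) v x p → x ∈ Q)
    (hfQ : ∫⁻ x in Q, ENNReal.ofReal (f x ^ n) ≤ ENNReal.ofReal (r ^ n)) :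
    N * volume (Metric.ball (0 : EuclideanSpace ℝ (Fin n)) 1) ≤
      ENNReal.ofReal ((2 / lam) ^ n * (2 ^ n * S ^ n + 1)) := by
  have hr0 : 0 < r := hM.trans_lt hr
  have hd := hv.d_pos
  set D := Metric.closedBall (0 : EuclideanSpace ℝ (Fin n)) (2 * d) with hD
  set K : Set (EuclideanSpace ℝ (Fin n)) := {p | r ≤ ‖p‖ ∧ ‖p‖ ≤ 2 ^ N * r} with hK
  have hKc : IsCompact K := by
    refine (isCompact_closedBall (0 : EuclideanSpace ℝ (Fin n)) (2 ^ N * r)).of_isClosed_subset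
      ?_ fun p hp => ?_
    · exact (isClosed_le continuous_const continuous_norm).inter
        (isClosed_le continuous_norm continuous_const)
    · rw [mem_closedBall_zero_iff]; exact hp.2
  set A := touchingSet D v K with hA
  have hAc : IsCompact A := isCompact_touchingSet (isCompact_closedBall _ _) hKc hv.lsc
  obtain ⟨L, hL0, hLip⟩ := exists_lipschitz_slope hv hlam hs hf hs0 hb hM hr hN
  choose! G hGK hG using (fun x (hx : x ∈ A) => hx.2)
  have hAD : A ⊆ D := fun x hx => hx.1
  have hAneg : ∀ x ∈ A, v x < 0 := by
    intro x hx
    have h1 := hv.affine_le (hG x hx) (hAD hx)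
    simp only [sub_self, inner_zero_right, add_zero] at h1
    have h2 : 3 * d * ‖G x‖ ≤ 3 * d * (2 ^ N * r) := by gcongr; exact (hGK x hx).2
    linarith
  have hAball : A ⊆ Metric.ball 0 d := fun x hx => hv.mem_ball x (hAneg x hx)
  have hAQ : A ⊆ Q := fun x hx => hQ x _ (hAneg x hx) (hG x hx)
  have hGL : LipschitzOnWith L.toNNReal G A := by
    refine LipschitzOnWith.of_dist_le_mul fun x hx y hy => ?_
    rw [dist_eq_norm, dist_eq_norm, Real.coe_toNNReal _ hL0]
    exact hLip y (hAD hy) x (hAD hx) _ _ (hG y hy) (hG x hx) (hGK y hy).1 (hGK y hy).2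
      (hGK x hx).2
  -- The Lipschitz bound at coinciding points shows that a slope in `K` is determined by its
  -- touching point, so the arbitrary choice `G` reaches every such slope.
  have huniq : ∀ x ∈ D, ∀ p ∈ K, IsSlope D v x p → x ∈ A ∧ G x = p := by
    intro x hx p hp hxp
    have hxA : x ∈ A := ⟨hx, p, hp, hxp⟩
    refine ⟨hxA, ?_⟩
    have := hLip x hx x hx p (G x) hxp (hG x hxA) hp.1 hp.2 (hGK x hxA).2
    rw [sub_self, norm_zero, mul_zero] at this
    exact sub_eq_zero.1 (norm_le_zero_iff.1 this)
  set Ak : ℕ → Set (EuclideanSpace ℝ (Fin n)) := fun k =>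
    (A ∩ G ⁻¹' Metric.closedBall 0 (2 ^ (k + 1) * r)) \
      (A ∩ G ⁻¹' Metric.closedBall 0 (2 ^ k * r)) with hAk
  have hAkm : ∀ k, MeasurableSet (Ak k) := fun k =>
    (hGL.continuousOn.preimage_isClosed_of_isClosed hAc.isClosed
      Metric.isClosed_closedBall).measurableSet.diff
    (hGL.continuousOn.preimage_isClosed_of_isClosed hAc.isClosed
      Metric.isClosed_closedBall).measurableSet
  have hAkmem : ∀ k x, x ∈ Ak k ↔ x ∈ A ∧ 2 ^ k * r < ‖G x‖ ∧ ‖G x‖ ≤ 2 ^ (k + 1) * r := by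
    intro k x
    simp only [hAk, Set.mem_sdiff, mem_inter_iff, mem_preimage, mem_closedBall_zero_iff, not_and, not_le]
    tauto
  have hAkA : ∀ k, Ak k ⊆ A := fun k x hx => ((hAkmem k x).1 hx).1
  have hdisj : Set.PairwiseDisjoint (↑(Finset.range N)) Ak := by
    have : ∀ i j, i < j → Disjoint (Ak i) (Ak j) := by
      intro i j hij
      rw [Set.disjoint_left]
      intro x hi hj
      have h1 := ((hAkmem i x).1 hi).2.2
      have h2 := ((hAkmem j x).1 hj).2.1
      have h3 : (2 : ℝ) ^ (i + 1) * r ≤ 2 ^ j * r := by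
        gcongr
        · norm_num
        · omega
      linarith
    intro i _ j _ hij
    rcases lt_or_gt_of_ne hij with h | h
    · exact this i j h
    · exact (this j i h).symm
  -- This is the Jacobian bound divided by `ρ^n`, made independent of `k` by `ρ ≥ r` in the `f`
  -- term. The factor `2^n` comes from splitting the power of a sum.
  set h : EuclideanSpace ℝ (Fin n) → ENNReal := fun x =>
    ENNReal.ofReal ((2 / lam) ^ n * 2 ^ n) * ENNReal.ofReal (s x ^ n) +
      ENNReal.ofReal ((2 / lam) ^ n / r ^ n) * ENNReal.ofReal (f x ^ n) with hh
  have hstep : ∀ k < N, volume (Metric.ball (0 : EuclideanSpace ℝ (Fin n)) 1) ≤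
      ∫⁻ x in Ak k, h x := by
    intro k hk
    set ρ := (2 : ℝ) ^ k * r with hρ
    have hρ2 : (2 : ℝ) ^ (k + 1) * r = 2 * ρ := by rw [hρ]; ring
    have hρ0 : 0 < ρ := by positivity
    have hrρ : r ≤ ρ := by
      have : (1 : ℝ) ≤ 2 ^ k := one_le_pow₀ (by norm_num)
      nlinarith
    have hann : Metric.closedBall (0 : EuclideanSpace ℝ (Fin n)) (2 * ρ) \ Metric.closedBall 0 ρ ⊆
        G '' Ak k := by
      rintro p ⟨hp1, hp2⟩
      rw [mem_closedBall_zero_iff] at hp1 hp2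
      rw [not_le] at hp2
      have hpK : p ∈ K := by
        refine ⟨hrρ.trans hp2.le, hp1.trans ?_⟩
        rw [← hρ2]
        gcongr
        · norm_num
        · omega
      obtain ⟨x, hx, hxp⟩ := hv.exists_slope p
      obtain ⟨hxA, rfl⟩ := huniq x hx p hpK hxp
      exact ⟨x, (hAkmem k x).2 ⟨hxA, hp2, by rw [hρ2]; exact hp1⟩, rfl⟩
    have hvol := volume_image_slope_le hv hlam hb hAneg hG (fun x hx =>
      ⟨hr.le.trans (hGK x hx).1, norm_pos_iff.1 (hr0.trans_le (hGK x hx).1)⟩) hGL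
      hAc.isClosed.measurableSet (hAkm k) (hAkA k)
    have hint : ∫⁻ x in Ak k, ENNReal.ofReal (((s x * ‖G x‖ + f x) / lam) ^ n) ≤
        ∫⁻ x in Ak k, ENNReal.ofReal (ρ ^ n) * h x := by
      refine setLIntegral_mono' (hAkm k) fun x hx => ?_
      have hx' := (hAkmem k x).1 hx
      rw [hρ2] at hx'
      have hsx := hs0 x
      have hfx := hf0 x
      simp only [hh]
      rw [← ENNReal.ofReal_mul (by positivity), ← ENNReal.ofReal_mul (by positivity),
        ← ENNReal.ofReal_add (by positivity) (by positivity), ← ENNReal.ofReal_mul (by positivity)]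
      refine ENNReal.ofReal_le_ofReal ?_
      have h1 : s x * ‖G x‖ + f x ≤ s x * (2 * ρ) + f x := by gcongr; exact hx'.2.2
      have h2 : (s x * (2 * ρ) + f x) ^ n ≤ 2 ^ n * ((s x * (2 * ρ)) ^ n + f x ^ n) := by
        refine (add_pow_le (by positivity) hfx n).trans ?_
        gcongr
        · norm_num
        · omega
      have h3 : 1 ≤ ρ ^ n / r ^ n := by
        rw [one_le_div (by positivity)]; gcongr
      calc ((s x * ‖G x‖ + f x) / lam) ^ n ≤ ((s x * (2 * ρ) + f x) / lam) ^ n := by gcongr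
        _ = (s x * (2 * ρ) + f x) ^ n / lam ^ n := by rw [div_pow]
        _ ≤ 2 ^ n * ((s x * (2 * ρ)) ^ n + 1 * f x ^ n) / lam ^ n := by
          rw [one_mul]; gcongr
        _ ≤ 2 ^ n * ((s x * (2 * ρ)) ^ n + ρ ^ n / r ^ n * f x ^ n) / lam ^ n := by gcongr
        _ = _ := by rw [mul_pow, mul_pow, div_pow]; field_simp
    rw [lintegral_const_mul' _ _ ENNReal.ofReal_ne_top] at hint
    have hfin := ((pow_mul_volume_ball_le_annulus hn hρ0).trans (measure_mono hann)).trans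
      (hvol.trans hint)
    have hne : ENNReal.ofReal (ρ ^ n) ≠ 0 := by
      rw [ne_eq, ENNReal.ofReal_eq_zero, not_le]; positivity
    exact (ENNReal.mul_le_mul_iff_right hne ENNReal.ofReal_ne_top).1 hfin
  have hsm : AEMeasurable (fun x => ENNReal.ofReal ((2 / lam) ^ n * 2 ^ n)
      * ENNReal.ofReal (s x ^ n)) (volume.restrict A) := by
    have h1 : ContinuousOn (fun x => s x ^ n) A := (hs.mono hAball).pow n
    exact ((h1.aemeasurable hAc.isClosed.measurableSet).ennreal_ofReal).const_mul _
  calc N * volume (Metric.ball (0 : EuclideanSpace ℝ (Fin n)) 1)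
      = ∑ _k ∈ Finset.range N, volume (Metric.ball (0 : EuclideanSpace ℝ (Fin n)) 1) := by simp
    _ ≤ ∑ k ∈ Finset.range N, ∫⁻ x in Ak k, h x :=
        Finset.sum_le_sum fun k hk => hstep k (Finset.mem_range.1 hk)
    _ = ∫⁻ x in ⋃ k ∈ Finset.range N, Ak k, h x :=
        (lintegral_biUnion_finset hdisj (fun k _ => hAkm k) _).symm
    _ ≤ ∫⁻ x in A, h x := lintegral_mono_set (iUnion₂_subset fun k _ => hAkA k)
    _ = ENNReal.ofReal ((2 / lam) ^ n * 2 ^ n) * (∫⁻ x in A, ENNReal.ofReal (s x ^ n)) +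
        ENNReal.ofReal ((2 / lam) ^ n / r ^ n) * ∫⁻ x in A, ENNReal.ofReal (f x ^ n) := by
      simp only [hh]
      rw [lintegral_add_left' hsm, lintegral_const_mul' _ _ ENNReal.ofReal_ne_top,
        lintegral_const_mul' _ _ ENNReal.ofReal_ne_top]
    _ ≤ ENNReal.ofReal ((2 / lam) ^ n * 2 ^ n) * ENNReal.ofReal (S ^ n) +
        ENNReal.ofReal ((2 / lam) ^ n / r ^ n) * ENNReal.ofReal (r ^ n) := by
      gcongr
      · exact (lintegral_mono_set hAball).trans hsS
      · exact (lintegral_mono_set hAQ).trans hfQ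
    _ = _ := by
      rw [← ENNReal.ofReal_mul (by positivity), ← ENNReal.ofReal_mul (by positivity),
        ← ENNReal.ofReal_add (by positivity) (by positivity)]
      congr 1
      field_simp

/-! ### The truncated supersolution and its convex hull -/

section

variable {n : ℕ} {d : ℝ} {u : EuclideanSpace ℝ (Fin n) → ℝ}

lemma exists_forall_le_closedBall (hu : LowerSemicontinuousOn u (Metric.closedBall 0 d))
    (hd : 0 < d) : ∃ x₀ ∈ Metric.closedBall (0 : EuclideanSpace ℝ (Fin n)) d,
      ∀ x ∈ Metric.closedBall (0 : EuclideanSpace ℝ (Fin n)) d, u x₀ ≤ u x := by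
  obtain ⟨x₀, hx₀, h⟩ := hu.exists_isMinOn (Metric.nonempty_closedBall.2 hd.le)
    (isCompact_closedBall _ _)
  exact ⟨x₀, hx₀, fun x hx => h hx⟩

lemma supNeg_nonneg (T : Set (EuclideanSpace ℝ (Fin n))) : 0 ≤ supNeg u T := by
  refine Real.sSup_nonneg ?_
  rintro _ ⟨x, _, rfl⟩
  exact le_max_right _ _

/-- Lower semicontinuity on a compact ball bounds `u⁻`, so `supNeg` is a genuine supremum and not
the default value of `sSup`. -/
lemma neg_supNeg_sphere_le (hu : LowerSemicontinuousOn u (Metric.closedBall 0 d))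
    (hd : 0 < d) {x : EuclideanSpace ℝ (Fin n)} (hx : x ∈ Metric.sphere 0 d) :
    0 ≤ u x + supNeg u (Metric.sphere 0 d) := by
  obtain ⟨x₀, _, h₀⟩ := exists_forall_le_closedBall hu hd
  have hbdd : BddAbove ((fun x => max (-u x) 0) '' Metric.sphere 0 d) := by
    refine ⟨max (-u x₀) 0, ?_⟩
    rintro _ ⟨y, hy, rfl⟩
    have := h₀ y (Metric.sphere_subset_closedBall hy)
    exact max_le_max (by linarith) le_rfl
  have h1 : max (-u x) 0 ≤ supNeg u (Metric.sphere 0 d) := le_csSup hbdd ⟨x, hx, rfl⟩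
  linarith [le_max_left (-u x) 0]

lemma truncExt_lt_zero {μ : ℝ} {x : EuclideanSpace ℝ (Fin n)} (hx : truncExt d μ u x < 0) :
    x ∈ Metric.ball 0 d ∧ truncExt d μ u x = u x + μ := by
  unfold truncExt at hx ⊢
  split_ifs at hx ⊢ with h
  · refine ⟨h, min_eq_left ?_⟩
    by_contra! hcon
    rw [min_eq_right hcon.le] at hx
    exact lt_irrefl _ hx
  · exact absurd hx (lt_irrefl _)

lemma truncExt_eq {μ : ℝ} {x : EuclideanSpace ℝ (Fin n)} (hx : x ∈ Metric.ball 0 d)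
    (hneg : u x + μ ≤ 0) : truncExt d μ u x = u x + μ := by
  unfold truncExt
  rw [if_pos hx, min_eq_left hneg]

/-- For `c < 0` the sublevel set is one of `u` on the closed ball, because the boundary inequality
excludes the sphere. This makes the extension by `0` harmless. -/
lemma lowerSemicontinuous_truncExt {μ : ℝ} (hu : LowerSemicontinuousOn u (Metric.closedBall 0 d))
    (hμ : ∀ x ∈ Metric.sphere (0 : EuclideanSpace ℝ (Fin n)) d, 0 ≤ u x + μ) :
    LowerSemicontinuous (truncExt d μ u) := by
  rw [lowerSemicontinuous_iff_isClosed_preimage]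
  intro c
  rcases le_or_gt 0 c with hc | hc
  · convert isClosed_univ
    refine eq_univ_of_forall fun x => ?_
    rw [mem_preimage, mem_Iic]
    refine le_trans ?_ hc
    unfold truncExt
    split_ifs
    · exact min_le_right _ _
    · exact le_rfl
  · obtain ⟨V, hV, hVu⟩ := lowerSemicontinuousOn_iff_preimage_Iic.1 hu (c - μ)
    have : truncExt d μ u ⁻¹' Iic c = Metric.closedBall 0 d ∩ u ⁻¹' Iic (c - μ) := by
      ext x
      simp only [mem_preimage, mem_Iic, mem_inter_iff]
      constructor
      · intro h
        obtain ⟨h1, h2⟩ := truncExt_lt_zero (h.trans_lt hc)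
        exact ⟨Metric.ball_subset_closedBall h1, by linarith⟩
      · rintro ⟨h1, h2⟩
        have h3 : x ∈ Metric.ball 0 d := by
          rw [← Metric.closedBall_sdiff_sphere]
          exact ⟨h1, fun h => by linarith [hμ x h]⟩
        rw [truncExt_eq h3 (by linarith)]
        linarith
    rw [this, hVu]
    exact Metric.isClosed_closedBall.inter hV

lemma isWell_truncExt (hu : LowerSemicontinuousOn u (Metric.closedBall 0 d)) (hd : 0 < d) {m : ℝ}
    (hm : 0 < m) (h : supNeg u (Metric.ball 0 d) = supNeg u (Metric.sphere 0 d) + m) :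
    IsWell d m (truncExt d (supNeg u (Metric.sphere 0 d)) u) := by
  refine ⟨hd, hm, lowerSemicontinuous_truncExt hu fun x hx => neg_supNeg_sphere_le hu hd hx,
    fun x => ?_, fun x hx => (truncExt_lt_zero hx).1, ?_⟩
  · unfold truncExt
    split_ifs
    · exact min_le_right _ _
    · exact le_rfl
  · obtain ⟨x₀, hx₀, h₀⟩ := exists_forall_le_closedBall hu hd
    have h1 : supNeg u (Metric.ball 0 d) ≤ max (-u x₀) 0 := by
      refine csSup_le ((Metric.nonempty_ball.2 hd).image _) ?_
      rintro _ ⟨y, hy, rfl⟩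
      have := h₀ y (Metric.ball_subset_closedBall hy)
      exact max_le_max (by linarith) le_rfl
    have h2 := supNeg_nonneg (u := u) (Metric.sphere 0 d)
    have h3 : u x₀ + supNeg u (Metric.sphere 0 d) ≤ -m := by
      rcases le_max_iff.1 h1 with h4 | h4 <;> linarith
    have h4 : x₀ ∈ Metric.ball 0 d := by
      rw [← Metric.closedBall_sdiff_sphere]
      exact ⟨hx₀, fun h => by linarith [neg_supNeg_sphere_le hu hd h]⟩
    exact ⟨x₀, by rw [truncExt_eq h4 (by linarith)]; exact h3⟩

lemma subjet_truncExt_subset {μ : ℝ} {x : EuclideanSpace ℝ (Fin n)}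
    (hx : truncExt d μ u x < 0) : subjet (truncExt d μ u) x ⊆ subjet u x := by
  rintro q ⟨hq, h⟩
  refine ⟨hq, fun ε hε => ?_⟩
  obtain ⟨h1, h2⟩ := truncExt_lt_zero hx
  filter_upwards [h ε hε, Metric.isOpen_ball.mem_nhds h1] with y hy hyb
  have h3 : truncExt d μ u y ≤ u y + μ := by
    unfold truncExt; rw [if_pos hyb]; exact min_le_left _ _
  linarith

/-- Where the truncation is negative, `u x < -μ`. Properness then allows `u x` to be replaced by
`-μ`, which freezes the second argument of `g`. -/
lemma hasConvexBound_truncExt {M lam μ : ℝ} {P : Set (EuclideanSpace ℝ (Fin n))}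
    {F : EuclideanSpace ℝ (Fin n) → ℝ → EuclideanSpace ℝ (Fin n) → Matrix (Fin n) (Fin n) ℝ → ℝ}
    {σ : EuclideanSpace ℝ (Fin n) → ℝ} {g : EuclideanSpace ℝ (Fin n) → ℝ → ℝ}
    (hP : P = univ ∨ P = {0}ᶜ) (hA : AssumptionA (Metric.ball 0 d) P M F)
    (hE : StrictlyEllipticLarge (Metric.ball 0 d) P M lam σ g F)
    (hS : IsSupersolution (Metric.ball 0 d) P F u) :
    HasConvexBound M lam (fun x => |σ x|) (fun x => max (g x (-μ)) 0) (truncExt d μ u) := by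
  intro x hx q hq hqM hq0 hpsd
  obtain ⟨hxb, hxv⟩ := truncExt_lt_zero hx
  have hqP : q.1 ∈ P := by
    rcases hP with rfl | rfl
    · exact mem_univ _
    · exact hq0
  have h1 := hS x hxb q (subjet_truncExt_subset hx hq) hqP
  have h2 := h1.trans (hA.proper x hxb q.1 hqP q.2 hq.1 (u x) (-μ) (by linarith))
  have h3 := hE x hxb _ q.1 hqP q.2 hpsd hqM h2
  have h4 : σ x * ‖q.1‖ ≤ |σ x| * ‖q.1‖ := by gcongr; exact le_abs_self _
  have h5 := le_max_left (g x (-μ)) 0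
  show lam * q.2.trace ≤ |σ x| * ‖q.1‖ + max (g x (-μ)) 0
  linarith

lemma convexOn_affine (p x : EuclideanSpace ℝ (Fin n)) (c : ℝ)
    {D : Set (EuclideanSpace ℝ (Fin n))} (hD : Convex ℝ D) :
    ConvexOn ℝ D fun y => c + inner ℝ p (y - x) := by
  refine ⟨hD, fun a _ b _ s t _ _ hst => le_of_eq ?_⟩
  simp only [inner_sub_right, inner_add_right, real_inner_smul_right, smul_eq_mul]
  obtain rfl : s = 1 - t := by linarith
  ring

lemma mem_upperBounds_convexMinorants {D : Set (EuclideanSpace ℝ (Fin n))}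
    {v : EuclideanSpace ℝ (Fin n) → ℝ} {x : EuclideanSpace ℝ (Fin n)} (hx : x ∈ D) :
    v x ∈ upperBounds {t | ∃ φ : EuclideanSpace ℝ (Fin n) → ℝ,
      ConvexOn ℝ D φ ∧ (∀ y ∈ D, φ y ≤ v y) ∧ t = φ x} := by
  rintro _ ⟨φ, _, h, rfl⟩
  exact h x hx

lemma convexHullOn_eq_of_isSlope {D : Set (EuclideanSpace ℝ (Fin n))} (hD : Convex ℝ D)
    {v : EuclideanSpace ℝ (Fin n) → ℝ} {x p : EuclideanSpace ℝ (Fin n)} (hx : x ∈ D)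
    (hp : IsSlope D v x p) : convexHullOn D v x = v x := by
  have hmem : v x ∈ {t | ∃ φ : EuclideanSpace ℝ (Fin n) → ℝ,
      ConvexOn ℝ D φ ∧ (∀ y ∈ D, φ y ≤ v y) ∧ t = φ x} :=
    ⟨fun y => v x + inner ℝ p (y - x), convexOn_affine p x _ hD, hp, by simp⟩
  exact IsGreatest.csSup_eq ⟨hmem, mem_upperBounds_convexMinorants hx⟩

/-- Each `x` in `B_d` equals `1/3 y₀ + 2/3 y`, with `y₀` a point of depth at least `m` and `y` in
`B_{2d}`. A convex minorant is at most `-m` at `y₀` and at most `0` at `y`. -/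
lemma convexHullOn_le {m : ℝ} {v : EuclideanSpace ℝ (Fin n) → ℝ} (hv : IsWell d m v)
    {x : EuclideanSpace ℝ (Fin n)} (hx : x ∈ Metric.ball 0 d) :
    convexHullOn (Metric.ball 0 (2 * d)) v x ≤ -m / 3 := by
  have hd := hv.d_pos
  obtain ⟨x₁, hx₁, h₁⟩ := hv.exists_slope 0
  -- The constant minorant, of slope `0`, shows that the set of minorant values is nonempty.
  refine csSup_le ⟨v x₁, fun y => v x₁ + inner ℝ 0 (y - x₁), convexOn_affine _ _ _
    (convex_ball _ _), fun y hy => h₁ y (Metric.ball_subset_closedBall hy), by simp⟩ ?_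
  rintro _ ⟨φ, hφ, hφv, rfl⟩
  obtain ⟨y₀, hy₀⟩ := hv.exists_le
  have hy₀b := hv.mem_ball y₀ (by linarith [hv.m_pos])
  rw [mem_ball_zero_iff] at hy₀b hx
  set y := (3 / 2 : ℝ) • x - (1 / 2 : ℝ) • y₀ with hy
  have hyb : y ∈ Metric.ball (0 : EuclideanSpace ℝ (Fin n)) (2 * d) := by
    rw [mem_ball_zero_iff]
    refine (norm_sub_le _ _).trans_lt ?_
    rw [norm_smul, norm_smul]
    norm_num
    linarith
  have hy₀b' : y₀ ∈ Metric.ball (0 : EuclideanSpace ℝ (Fin n)) (2 * d) := by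
    rw [mem_ball_zero_iff]; linarith
  have h2 := hφ.2 hy₀b' hyb (by norm_num : (0 : ℝ) ≤ 1 / 3) (by norm_num : (0 : ℝ) ≤ 2 / 3)
    (by norm_num)
  have h3 : (1 / 3 : ℝ) • y₀ + (2 / 3 : ℝ) • y = x := by rw [hy]; module
  rw [h3] at h2
  simp only [smul_eq_mul] at h2
  have h4 := hφv _ hy₀b'
  have h5 := (hφv _ hyb).trans (hv.nonpos y)
  linarith

lemma mem_contactSet_of_isSlope {x p : EuclideanSpace ℝ (Fin n)} (hd : 0 < d)
    (hx : truncExt d (supNeg u (Metric.sphere 0 d)) u x < 0)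
    (hp : IsSlope (Metric.closedBall 0 (2 * d)) (truncExt d (supNeg u (Metric.sphere 0 d)) u) x p) :
    x ∈ contactSet d u := by
  obtain ⟨h1, h2⟩ := truncExt_lt_zero hx
  refine ⟨h1, ?_⟩
  show u x + _ = Gam d u x
  rw [← h2, Gam, convexHullOn_eq_of_isSlope (convex_ball _ _)
    (Metric.ball_subset_ball (by linarith) h1)
    fun y hy => hp y (Metric.ball_subset_closedBall hy)]

/-- This confines the contact set to a compact subset of the open ball, where `f` is bounded
although `g` need not be up to the boundary. -/
lemma contactSet_subset {m : ℝ}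
    (hv : IsWell d m (truncExt d (supNeg u (Metric.sphere 0 d)) u)) :
    contactSet d u ⊆ {x | truncExt d (supNeg u (Metric.sphere 0 d)) u x ≤ -m / 3} := by
  rintro x ⟨hx, hxu⟩
  have h1 : u x + supNeg u (Metric.sphere 0 d) ≤ -m / 3 := by
    rw [show u x + supNeg u (Metric.sphere 0 d) = Gam d u x from hxu]
    exact convexHullOn_le hv hx
  show truncExt _ _ _ _ ≤ _
  rw [truncExt_eq hx (by linarith [hv.m_pos])]
  exact h1

end

lemma lintegral_abs_pow_le_of_eLpNorm_le {n : ℕ} (hn : 1 ≤ n) {α : Type*} [MeasurableSpace α]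
    {μ : Measure α} {σ : α → ℝ} {S : ℝ} (hS : 0 ≤ S)
    (h : eLpNorm σ (n : ENNReal) μ ≤ ENNReal.ofReal S) :
    ∫⁻ x, ENNReal.ofReal (|σ x| ^ n) ∂μ ≤ ENNReal.ofReal (S ^ n) := by
  have hn0 : (n : ENNReal) ≠ 0 := by simp; omega
  have hn' : (0 : ℝ) < n := by exact_mod_cast hn
  rw [eLpNorm_eq_lintegral_rpow_enorm_toReal hn0 (ENNReal.natCast_ne_top n),
    ENNReal.toReal_natCast, one_div, ENNReal.rpow_inv_le_iff hn', ENNReal.rpow_natCast,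
    ← ENNReal.ofReal_pow hS] at h
  refine le_trans (le_of_eq (lintegral_congr fun x => ?_)) h
  rw [ENNReal.ofReal_pow (abs_nonneg _), ENNReal.rpow_natCast, Real.enorm_eq_ofReal_abs]

end ABP

/-! ### The estimate -/

theorem theorem1 (n : ℕ) (hn : 1 ≤ n) (lam : ℝ) (hlam : 0 < lam) (S : ℝ) (hS : 0 ≤ S) :
    ∃ C : ℝ, 0 < C ∧
      ∀ (d : ℝ) (_ : 0 < d) (M : ℝ) (_ : 0 ≤ M)
        (P : Set (EuclideanSpace ℝ (Fin n))) (_ : P = Set.univ ∨ P = {0}ᶜ)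
        (F : EuclideanSpace ℝ (Fin n) → ℝ → EuclideanSpace ℝ (Fin n) →
          Matrix (Fin n) (Fin n) ℝ → ℝ)
        (σ : EuclideanSpace ℝ (Fin n) → ℝ) (g : EuclideanSpace ℝ (Fin n) → ℝ → ℝ)
        (u : EuclideanSpace ℝ (Fin n) → ℝ),
        ContinuousOn σ (Metric.ball 0 d) →
        ContinuousOn (fun q : EuclideanSpace ℝ (Fin n) × ℝ => g q.1 q.2)
          (Metric.ball 0 d ×ˢ Set.univ) →
        eLpNorm σ (n : ENNReal) (volume.restrict (Metric.ball 0 d)) ≤ ENNReal.ofReal S →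
        ABP.AssumptionA (Metric.ball 0 d) P M F →
        ABP.StrictlyEllipticLarge (Metric.ball 0 d) P M lam σ g F →
        LowerSemicontinuousOn u (Metric.closedBall 0 d) →
        ABP.IsSupersolution (Metric.ball 0 d) P F u →
        ABP.supNeg u (Metric.ball 0 d) ≤
          ABP.supNeg u (Metric.sphere 0 d) +
            C * d * (M +
              (∫ x in ABP.contactSet d u,
                (max (g x (-ABP.supNeg u (Metric.sphere 0 d))) 0) ^ n) ^ ((1 : ℝ) / n)) := by
  set ω := volume (Metric.ball (0 : EuclideanSpace ℝ (Fin n)) 1) with hω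
  have hωfin : ω ≠ ⊤ := measure_ball_lt_top.ne
  have hω0 : 0 < ω.toReal :=
    ENNReal.toReal_pos (Metric.measure_ball_pos _ _ one_pos).ne' hωfin
  -- `N` is one the annulus count rules out. A depth above `3 · 2^N d (M + δ)` would leave room for
  -- `N` annuli.
  obtain ⟨N, hN⟩ := exists_nat_gt ((2 / lam) ^ n * (2 ^ n * S ^ n + 1) / ω.toReal)
  refine ⟨3 * 2 ^ N, by positivity, ?_⟩
  intro d hd M hM P hP F σ g u hσ hg hσS hA hE hu hsup
  by_contra! hcon
  set μ := ABP.supNeg u (Metric.sphere 0 d) with hμ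
  set f : EuclideanSpace ℝ (Fin n) → ℝ := fun x => max (g x (-μ)) 0 with hf
  have hf0 : ∀ x, 0 ≤ f x := fun x => le_max_right _ _
  have hfc : ContinuousOn f (Metric.ball 0 d) := by
    have h1 : ContinuousOn (fun x => g x (-μ)) (Metric.ball 0 d) :=
      hg.comp (f := fun x => (x, -μ)) (by fun_prop) fun x hx => ⟨hx, mem_univ _⟩
    exact h1.sup continuousOn_const
  set I := ∫ x in ABP.contactSet d u, f x ^ n with hI
  have hI0 : 0 ≤ I := integral_nonneg fun x => pow_nonneg (hf0 x) n
  set δ := I ^ ((1 : ℝ) / n) with hδ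
  have hδ0 : 0 ≤ δ := Real.rpow_nonneg hI0 _
  have hδI : δ ^ n = I := by
    rw [hδ, one_div]; exact Real.rpow_inv_natCast_pow hI0 (by omega)
  obtain ⟨m, hm⟩ : ∃ m, m = ABP.supNeg u (Metric.ball 0 d) - μ := ⟨_, rfl⟩
  have hm1 : 3 * 2 ^ N * d * (M + δ) < m := by linarith
  have hm0 : 0 < m := lt_of_le_of_lt (by positivity) hm1
  have hv := ABP.isWell_truncExt hu hd hm0 (by linarith)
  -- `r > M` reaches the elliptic range, `r > δ` makes the integral of `f^n` at most `r^n`, and the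
  -- upper bound keeps `3d · 2^N r` below the depth.
  obtain ⟨r, hr1, hr2⟩ : ∃ r, M + δ < r ∧ r < m / (3 * 2 ^ N * d) :=
    exists_between (by rw [lt_div_iff₀ (by positivity)]; linarith)
  rw [lt_div_iff₀ (by positivity)] at hr2
  -- Without integrability the Bochner integral would be `0` by convention and would not control the
  -- Lebesgue integral.
  have hint : IntegrableOn (fun x => f x ^ n) (ABP.contactSet d u) := by
    have hc := hv.isCompact_le (c := -m / 3) (by linarith)
    refine IntegrableOn.mono_set (ContinuousOn.integrableOn_compact hc ?_) (ABP.contactSet_subset hv)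
    exact (hfc.mono fun x hx => hv.mem_ball x (lt_of_le_of_lt hx (by linarith))).pow n
  have hfQ : ∫⁻ x in ABP.contactSet d u, ENNReal.ofReal (f x ^ n) ≤ ENNReal.ofReal (r ^ n) := by
    rw [← ofReal_integral_eq_lintegral_ofReal hint (ae_of_all _ fun x => pow_nonneg (hf0 x) n)]
    refine ENNReal.ofReal_le_ofReal ?_
    show I ≤ r ^ n
    rw [← hδI]
    gcongr
    linarith
  have hfin := ABP.mul_volume_ball_le hn (r := r) (N := N) hv hlam hσ.abs hfc
    (fun x => abs_nonneg _) hf0 (ABP.hasConvexBound_truncExt hP hA hE hsup) hM (by linarith)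
    (by linarith) hS (ABP.lintegral_abs_pow_le_of_eLpNorm_le hn hS hσS)
    (fun x p hx hp => ABP.mem_contactSet_of_isSlope hd hx hp) hfQ
  rw [div_lt_iff₀ hω0] at hN
  have h1 := ENNReal.toReal_mono ENNReal.ofReal_ne_top hfin
  rw [ENNReal.toReal_mul, ENNReal.toReal_natCast, ENNReal.toReal_ofReal (by positivity)] at h1
  linarith
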